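/- Let $G$ be a (discrete) group and $\Bbbk$ an algebraically closed field. **Terminology.** A $\Bbbk$-additive monoidal category is a monoidal category whose Hom-sets are $\Bbbk$-modules, whose composition and monoidal product are $\Bbbk$-bilinear, and in which every finite family of objects has a direct sum. A *pivotal* category is a monoidal category in which every object $X$ has an object $X^*$ that is at once a left dual of $X$ (through $\mathrm{ev}_X\colon X^*\otimes X\to\mathbb 1$, $\mathrm{coev}_X\colon\mathbb 1\to X\otimes X^*$) and a right dual of $X$ (through $\widetilde{\mathrm{ev}}_X\colon X\otimes X^*\to\mathbb 1$, $\widetilde{\mathrm{coev}}_X\colon\mathbb 1\to X^*\otimes X$), such that the left and right dual functors coincide as monoidal functors; set $\dim_l(X)=\mathrm{ev}_X\widetilde{\mathrm{coev}}_X$ and $\dim_r(X)=\widetilde{\mathrm{ev}}_X\mathrm{coev}_X$ in $\mathrm{End}(\mathbb 1)$. An object $i$ is *simple* if $\mathrm{End}(i)$ is a free $\Bbbk$-module of rank $1$. A $\Bbbk$-additive category is *split semisimple* if each object is a finite direct sum of simple objects and $\mathrm{Hom}(i,j)=0$ for any non-isomorphic simple objects $i,j$. A *$G$-graded category* is a $\Bbbk$-additive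 monoidal category $\mathcal C$ with full subcategories $\{\mathcal C_\alpha\}_{\alpha\in G}$, each closed under finite direct sums (that is, every finite family of objects of $\mathcal C_\alpha$ has a direct sum in $\mathcal C_\alpha$), such that each object of $\mathcal C$ is a finite direct sum $\bigoplus_\alpha X_\alpha$ with $X_\alpha\in\mathcal C_\alpha$; $X\otimes Y\in\mathcal C_{\alpha\beta}$ for $X\in\mathcal C_\alpha$, $Y\in\mathcal C_\beta$; $\mathrm{Hom}(X,Y)=0$ for $X\in\mathcal C_\alpha$, $Y\in\mathcal C_\beta$, $\alpha\ne\beta$; and $\mathbb 1\in\mathcal C_1$. (Hence distinct $\mathcal C_\alpha$ share at most zero objects.) If $\mathcal C$ is pivotal, duals are chosen so that $X^*\in\mathcal C_{\alpha^{-1}}$ for $X\in\mathcal C_\alpha$. A *$G$-fusion category* is a pivotal $G$-graded category that is split semisimple, whose unit object is simple, and such that for every $\alpha\in G$ the category $\mathcal C_\alpha$ has at least one simple object and only finitely many isomorphism classes of simple objects. The *$G$-center* $\mathcal Z_G(\mathcal C)$ has as objects the pairs $(A,\sigma)$ where $A\in\mathcal C$ and $\sigma=\{\sigma_X\colon A\otimes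 X\to X\otimes A\}_{X\in\mathcal C_1}$ is a family of isomorphisms natural in $X\in\mathcal C_1$ with $\sigma_{X\otimes Y}=(\mathrm{id}_X\otimes\sigma_Y)(\sigma_X\otimes\mathrm{id}_Y)$ up to the associativity constraints. Its morphisms $(A,\sigma)\to(A',\sigma')$ are the morphisms $f\colon A\to A'$ of $\mathcal C$ with $(\mathrm{id}_X\otimes f)\sigma_X=\sigma'_X(f\otimes\mathrm{id}_X)$ for all $X\in\mathcal C_1$. Its monoidal product is $(A,\sigma)\otimes(B,\rho)=(A\otimes B,(\sigma\otimes\mathrm{id}_B)(\mathrm{id}_A\otimes\rho))$, its $\Bbbk$-linear structure is that of $\mathcal C$, its pivotal structure is $(A,\sigma)^*=(A^*,\sigma^\dagger)$ with the (co)evaluations of $A$, where $\sigma^\dagger_X=(\mathrm{ev}_A\otimes\mathrm{id}_{X\otimes A^*})(\mathrm{id}_{A^*}\otimes\sigma_X^{-1}\otimes\mathrm{id}_{A^*})(\mathrm{id}_{A^*\otimes X}\otimes\mathrm{coev}_A)$, and $\mathcal Z_\alpha(\mathcal C)$ is the full subcategory of the pairs $(A,\sigma)$ with $A\in\mathcal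 C_\alpha$. **Lemma.** Let $\mathcal C$ be a $G$-fusion category over $\Bbbk$ such that $$\dim(\mathcal C_1)=\sum_{i}\dim_l(i)\dim_r(i)\neq 0,$$ where $i$ runs over a representative set of simple objects of $\mathcal C_1$. Then $\mathcal Z_G(\mathcal C)$, with the structure above, is a $G$-fusion category over $\Bbbk$. Moreover, if the subcategories $\mathcal C_\alpha$ are pairwise disjoint as classes of objects, then so are the subcategories $\mathcal Z_\alpha(\mathcal C)$. -/

import Mathlib

open CategoryTheory CategoryTheory.Limits CategoryTheory.MonoidalCategory

universe w w' v u

noncomputable section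

namespace TV

section Pivotal

/-- A choice of left and right duals on the same objects. -/
class DualityData (C : Type u) [Category.{v} C] [MonoidalCategory C] where
  /-- The dual object `X^*`. -/
  dual : C → C
  /-- `X^*` is a left dual of `X`, through `ev` and `coev`. -/
  left (X : C) : ExactPairing X (dual X)
  /-- `X^*` is a right dual of `X`, through the other evaluation and coevaluation. -/
  right (X : C) : ExactPairing (dual X) X

variable {C : Type u} [Category.{v} C] [MonoidalCategory C] [DualityData C]

/-- The dual object `X^*`. -/
abbrev dual (X : C) : C := DualityData.dual X

/-- `ev_X : X^* ⊗ X ⟶ 𝟙`. -/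
def ev (X : C) : dual X ⊗ X ⟶ 𝟙_ C := (DualityData.left X).evaluation'

/-- `coev_X : 𝟙 ⟶ X ⊗ X^*`. -/
def coev (X : C) : 𝟙_ C ⟶ X ⊗ dual X := (DualityData.left X).coevaluation'

/-- The right evaluation `X ⊗ X^* ⟶ 𝟙`. -/
def evR (X : C) : X ⊗ dual X ⟶ 𝟙_ C := (DualityData.right X).evaluation'

/-- The right coevaluation `𝟙 ⟶ X^* ⊗ X`. -/
def coevR (X : C) : 𝟙_ C ⟶ dual X ⊗ X := (DualityData.right X).coevaluation'

/-- The left dual `Y^* ⟶ X^*` of a morphism `f : X ⟶ Y`. -/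
def leftDualMap {X Y : C} (f : X ⟶ Y) : dual Y ⟶ dual X :=
  (ρ_ _).inv ≫ dual Y ◁ coev X ≫ dual Y ◁ f ▷ dual X ≫ (α_ _ _ _).inv ≫
    ev Y ▷ dual X ≫ (λ_ _).hom

/-- The right dual `Y^* ⟶ X^*` of a morphism `f : X ⟶ Y`. -/
def rightDualMap {X Y : C} (f : X ⟶ Y) : dual Y ⟶ dual X :=
  (λ_ _).inv ≫ coevR X ▷ dual Y ≫ (dual X ◁ f) ▷ dual Y ≫ (α_ _ _ _).hom ≫
    dual X ◁ evR Y ≫ (ρ_ _).hom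

/-- The left monoidal constraint `X^* ⊗ Y^* ⟶ (Y ⊗ X)^*`. -/
def leftConstraint (X Y : C) : dual X ⊗ dual Y ⟶ dual (Y ⊗ X) :=
  (ρ_ _).inv ≫ (dual X ⊗ dual Y) ◁ coev (Y ⊗ X) ≫
    (α_ _ _ _).hom ≫ dual X ◁ (dual Y ◁ (α_ _ _ _).hom ≫ (α_ _ _ _).inv ≫
      ev Y ▷ (X ⊗ dual (Y ⊗ X)) ≫ (λ_ _).hom) ≫
    (α_ _ _ _).inv ≫ ev X ▷ dual (Y ⊗ X) ≫ (λ_ _).hom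

/-- The right monoidal constraint `X^* ⊗ Y^* ⟶ (Y ⊗ X)^*`. -/
def rightConstraint (X Y : C) : dual X ⊗ dual Y ⟶ dual (Y ⊗ X) :=
  (λ_ _).inv ≫ coevR (Y ⊗ X) ▷ (dual X ⊗ dual Y) ≫
    (α_ _ _ _).inv ≫ ((α_ _ _ _).inv ▷ dual X ≫ (α_ _ _ _).hom ≫
      (dual (Y ⊗ X) ⊗ Y) ◁ evR X ≫ (ρ_ _).hom) ▷ dual Y ≫
    (α_ _ _ _).hom ≫ dual (Y ⊗ X) ◁ evR Y ≫ (ρ_ _).hom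

variable (C) in
/-- The left monoidal unit constraint `𝟙 ⟶ 𝟙^*`. -/
def leftUnitConstraint : 𝟙_ C ⟶ dual (𝟙_ C) := coev (𝟙_ C) ≫ (λ_ _).hom

variable (C) in
/-- The right monoidal unit constraint `𝟙 ⟶ 𝟙^*`. -/
def rightUnitConstraint : 𝟙_ C ⟶ dual (𝟙_ C) := coevR (𝟙_ C) ≫ (ρ_ _).hom

end Pivotal

/-- A pivotal category: the left and the right dual functors are equal as monoidal functors. -/
class PivotalCategory (C : Type u) [Category.{v} C] [MonoidalCategory C] extends
    DualityData C where
  map_eq {X Y : C} (f : X ⟶ Y) : leftDualMap f = rightDualMap f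
  constraint_eq (X Y : C) : leftConstraint X Y = rightConstraint X Y
  unitConstraint_eq : leftUnitConstraint C = rightUnitConstraint C

section Trace

variable {C : Type u} [Category.{v} C] [MonoidalCategory C] [PivotalCategory C]

/-- The left trace. -/
def trL {X : C} (g : X ⟶ X) : 𝟙_ C ⟶ 𝟙_ C := coevR X ≫ dual X ◁ g ≫ ev X

/-- The right trace. -/
def trR {X : C} (g : X ⟶ X) : 𝟙_ C ⟶ 𝟙_ C := coev X ≫ g ▷ dual X ≫ evR X

/-- The left dimension. -/
def dimL (X : C) : 𝟙_ C ⟶ 𝟙_ C := trL (𝟙 X)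

/-- The right dimension. -/
def dimR (X : C) : 𝟙_ C ⟶ 𝟙_ C := trR (𝟙 X)

end Trace

end TV

namespace TV
variable {C : Type u} [Category.{v} C] [MonoidalCategory C]

/-- A half braiding on `A` relative to the full monoidal subcategory of `C` with objects `P`. -/
structure RelHalfBraiding (P : ObjectProperty C) [P.IsMonoidal] (A : C) where
  β (U : C) (hU : P U) : A ⊗ U ≅ U ⊗ A
  naturality {U V : C} (hU : P U) (hV : P V) (f : U ⟶ V) :
    A ◁ f ≫ (β V hV).hom = (β U hU).hom ≫ f ▷ A
  monoidal (U V : C) (hU : P U) (hV : P V) :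
    (β (U ⊗ V) (P.prop_tensor hU hV)).hom =
      (α_ _ _ _).inv ≫ (β U hU).hom ▷ V ≫ (α_ _ _ _).hom ≫ U ◁ (β V hV).hom ≫ (α_ _ _ _).inv

/-- Objects of the relative center. -/
structure RelCenter (P : ObjectProperty C) [P.IsMonoidal] where
  pt : C
  half : RelHalfBraiding P pt

namespace RelCenter

variable {P : ObjectProperty C} [P.IsMonoidal]

/-- The half braiding as a morphism. -/
abbrev σ (A : RelCenter P) (U : C) (hU : P U) : A.pt ⊗ U ⟶ U ⊗ A.pt := (A.half.β U hU).hom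

/-- Morphisms of the relative center. -/
@[ext]
structure Hom (A B : RelCenter P) where
  f : A.pt ⟶ B.pt
  comm (U : C) (hU : P U) : f ▷ U ≫ B.σ U hU = A.σ U hU ≫ U ◁ f

instance : Category (RelCenter P) where
  Hom := Hom
  id A := { f := 𝟙 A.pt, comm := by intros; simp }
  comp f g := { f := f.f ≫ g.f
                comm := by
                  intro U hU
                  rw [comp_whiskerRight, Category.assoc, g.comm, ← Category.assoc, f.comm]
                  simp }

@[ext] lemma hom_ext {A B : RelCenter P} {f g : A ⟶ B} (h : Hom.f f = Hom.f g) : f = g :=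
  Hom.ext h

@[simp] lemma id_f (A : RelCenter P) : Hom.f (𝟙 A) = 𝟙 A.pt := rfl
@[simp] lemma comp_f {A B D : RelCenter P} (f : A ⟶ B) (g : B ⟶ D) :
    Hom.f (f ≫ g) = Hom.f f ≫ Hom.f g := rfl

lemma hom_comm {A B : RelCenter P} (f : A ⟶ B) (U : C) (hU : P U) :
    Hom.f f ▷ U ≫ B.σ U hU = A.σ U hU ≫ U ◁ Hom.f f := f.comm U hU

/-- A morphism of the relative center whose underlying morphism is invertible is invertible. -/
def isoMk {A B : RelCenter P} (e : A.pt ≅ B.pt)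
    (comm : ∀ (U : C) (hU : P U), e.hom ▷ U ≫ B.σ U hU = A.σ U hU ≫ U ◁ e.hom) : A ≅ B where
  hom := ⟨e.hom, comm⟩
  inv := ⟨e.inv, fun U hU => by
    rw [← cancel_epi (e.hom ▷ U), ← comp_whiskerRight_assoc, e.hom_inv_id, id_whiskerRight,
      Category.id_comp, ← Category.assoc, comm, Category.assoc, ← MonoidalCategory.whiskerLeft_comp,
      e.hom_inv_id, MonoidalCategory.whiskerLeft_id, Category.comp_id]⟩
  hom_inv_id := by ext; exact e.hom_inv_id
  inv_hom_id := by ext; exact e.inv_hom_id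

/-- The tensor product of relative half braidings. -/
def tensorHalf (A B : RelCenter P) : RelHalfBraiding P (A.pt ⊗ B.pt) where
  β U hU := α_ _ _ _ ≪≫ whiskerLeftIso A.pt (B.half.β U hU) ≪≫ (α_ _ _ _).symm ≪≫
    whiskerRightIso (A.half.β U hU) B.pt ≪≫ α_ _ _ _
  naturality {U V} hU hV f := by
    simp only [Iso.trans_hom, whiskerLeftIso_hom, Iso.symm_hom, whiskerRightIso_hom]
    calc
      _ = 𝟙 _ ⊗≫ (A.pt ◁ (B.pt ◁ f ≫ (B.half.β V hV).hom)) ⊗≫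
            (A.half.β V hV).hom ▷ B.pt ⊗≫ 𝟙 _ := by monoidal
      _ = 𝟙 _ ⊗≫ A.pt ◁ (B.half.β U hU).hom ⊗≫
            (A.pt ◁ f ≫ (A.half.β V hV).hom) ▷ B.pt ⊗≫ 𝟙 _ := by
          rw [B.half.naturality hU hV]; monoidal
      _ = _ := by rw [A.half.naturality hU hV]; monoidal
  monoidal U V hU hV := by
    simp only [Iso.trans_hom, whiskerLeftIso_hom, Iso.symm_hom, whiskerRightIso_hom]
    rw [A.half.monoidal U V hU hV, B.half.monoidal U V hU hV]
    calc
      _ = 𝟙 _ ⊗≫ A.pt ◁ (B.half.β U hU).hom ▷ V ⊗≫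
            (_ ◁ (B.half.β V hV).hom ≫ (A.half.β U hU).hom ▷ _) ⊗≫
              U ◁ (A.half.β V hV).hom ▷ B.pt ⊗≫ 𝟙 _ := by monoidal
      _ = _ := by rw [whisker_exchange]; monoidal

/-- The half braiding on the unit. -/
def unitHalf : RelHalfBraiding P (𝟙_ C) where
  β U _ := λ_ U ≪≫ (ρ_ U).symm
  naturality _ _ f := by simp
  monoidal U V hU hV := by simp

lemma tensor_comm_left (A : RelCenter P) {B B' : RelCenter P} (f : B ⟶ B') (U : C) (hU : P U) :
    (A.pt ◁ Hom.f f) ▷ U ≫ ((tensorHalf A B').β U hU).hom =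
      ((tensorHalf A B).β U hU).hom ≫ U ◁ (A.pt ◁ Hom.f f) := by
  simp only [tensorHalf, Iso.trans_hom, whiskerLeftIso_hom, Iso.symm_hom, whiskerRightIso_hom]
  calc
    _ = 𝟙 _ ⊗≫ A.pt ◁ (Hom.f f ▷ U ≫ B'.σ U hU) ⊗≫ A.σ U hU ▷ B'.pt ⊗≫ 𝟙 _ := by monoidal
    _ = 𝟙 _ ⊗≫ A.pt ◁ B.σ U hU ⊗≫ ((A.pt ⊗ U) ◁ Hom.f f ≫ A.σ U hU ▷ B'.pt) ⊗≫ 𝟙 _ := by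
        rw [hom_comm]; monoidal
    _ = _ := by rw [whisker_exchange]; monoidal

lemma tensor_comm_right {A A' : RelCenter P} (f : A ⟶ A') (B : RelCenter P) (U : C) (hU : P U) :
    (Hom.f f ▷ B.pt) ▷ U ≫ ((tensorHalf A' B).β U hU).hom =
      ((tensorHalf A B).β U hU).hom ≫ U ◁ (Hom.f f ▷ B.pt) := by
  simp only [tensorHalf, Iso.trans_hom, whiskerLeftIso_hom, Iso.symm_hom, whiskerRightIso_hom]
  calc
    _ = 𝟙 _ ⊗≫ (Hom.f f ▷ (B.pt ⊗ U) ≫ A'.pt ◁ B.σ U hU) ⊗≫ A'.σ U hU ▷ B.pt ⊗≫ 𝟙 _ := by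
        monoidal
    _ = 𝟙 _ ⊗≫ A.pt ◁ B.σ U hU ⊗≫ (Hom.f f ▷ U ≫ A'.σ U hU) ▷ B.pt ⊗≫ 𝟙 _ := by
        rw [← whisker_exchange]; monoidal
    _ = _ := by rw [hom_comm]; monoidal

/-- The monoidal structure of the relative center. -/
instance : MonoidalCategoryStruct (RelCenter P) where
  tensorObj A B := ⟨A.pt ⊗ B.pt, tensorHalf A B⟩
  tensorUnit := ⟨𝟙_ C, unitHalf⟩
  whiskerLeft A _ _ f := ⟨A.pt ◁ Hom.f f, tensor_comm_left A f⟩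
  whiskerRight f B := ⟨Hom.f f ▷ B.pt, tensor_comm_right f B⟩
  associator A B D := isoMk (α_ A.pt B.pt D.pt) (fun U hU => by
    simp [σ, tensorHalf])
  leftUnitor A := isoMk (λ_ A.pt) (fun U hU => by
    simp [σ, tensorHalf, unitHalf])
  rightUnitor A := isoMk (ρ_ A.pt) (fun U hU => by
    simp [σ, tensorHalf, unitHalf])

@[simp] lemma tensor_pt (A B : RelCenter P) : (A ⊗ B).pt = A.pt ⊗ B.pt := rfl
@[simp] lemma unit_pt : (𝟙_ (RelCenter P)).pt = 𝟙_ C := rfl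
@[simp] lemma whiskerLeft_f (A : RelCenter P) {B B' : RelCenter P} (f : B ⟶ B') :
    Hom.f (A ◁ f) = A.pt ◁ Hom.f f := rfl
@[simp] lemma whiskerRight_f {A A' : RelCenter P} (f : A ⟶ A') (B : RelCenter P) :
    Hom.f (f ▷ B) = Hom.f f ▷ B.pt := rfl
@[simp] lemma tensorHom_f {A A' B B' : RelCenter P} (f : A ⟶ A') (g : B ⟶ B') :
    Hom.f (f ⊗ₘ g) = Hom.f f ⊗ₘ Hom.f g := (MonoidalCategory.tensorHom_def _ _).symm
@[simp] lemma associator_hom_f (A B D : RelCenter P) :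
    Hom.f (α_ A B D).hom = (α_ A.pt B.pt D.pt).hom := rfl
@[simp] lemma associator_inv_f (A B D : RelCenter P) :
    Hom.f (α_ A B D).inv = (α_ A.pt B.pt D.pt).inv := rfl
@[simp] lemma leftUnitor_hom_f (A : RelCenter P) : Hom.f (λ_ A).hom = (λ_ A.pt).hom := rfl
@[simp] lemma leftUnitor_inv_f (A : RelCenter P) : Hom.f (λ_ A).inv = (λ_ A.pt).inv := rfl
@[simp] lemma rightUnitor_hom_f (A : RelCenter P) : Hom.f (ρ_ A).hom = (ρ_ A.pt).hom := rfl
@[simp] lemma rightUnitor_inv_f (A : RelCenter P) : Hom.f (ρ_ A).inv = (ρ_ A.pt).inv := rfl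

instance : MonoidalCategory (RelCenter P) where
  tensorHom_def _ _ := rfl
  id_tensorHom_id _ _ := by ext; simp
  tensorHom_comp_tensorHom _ _ _ _ := by ext; simp
  whiskerLeft_id _ _ := by ext; simp
  id_whiskerRight _ _ := by ext; simp
  associator_naturality _ _ _ := by ext; simp
  leftUnitor_naturality _ := by ext; simp
  rightUnitor_naturality _ := by ext; simp
  pentagon _ _ _ _ := by ext; simp
  triangle _ _ := by ext; simp

end RelCenter
end TV

namespace TV
section Nested
variable {C : Type u} [Category.{v} C] [MonoidalCategory C]

/-- The mate of `f : X ⟶ Y` through a coevaluation of `X` and an evaluation of `Y`. -/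
def mateL {X Y X' Y' : C} (c : 𝟙_ C ⟶ X ⊗ X') (e : Y' ⊗ Y ⟶ 𝟙_ C) (f : X ⟶ Y) : Y' ⟶ X' :=
  (ρ_ _).inv ≫ Y' ◁ c ≫ Y' ◁ f ▷ X' ≫ (α_ _ _ _).inv ≫ e ▷ X' ≫ (λ_ _).hom

/-- The mate of `f : X ⟶ Y` through a coevaluation of `X` and an evaluation of `Y`. -/
def mateR {X Y X' Y' : C} (c : 𝟙_ C ⟶ X' ⊗ X) (e : Y ⊗ Y' ⟶ 𝟙_ C) (f : X ⟶ Y) : Y' ⟶ X' :=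
  (λ_ _).inv ≫ c ▷ Y' ≫ (X' ◁ f) ▷ Y' ≫ (α_ _ _ _).hom ≫ X' ◁ e ≫ (ρ_ _).hom

lemma mateL_comp {X Y Z X' Y' Z' : C} (pX : ExactPairing X X') (pY : ExactPairing Y Y')
    (pZ : ExactPairing Z Z') (f : X ⟶ Y) (g : Y ⟶ Z) :
    mateL pY.coevaluation' pZ.evaluation' g ≫ mateL pX.coevaluation' pY.evaluation' f =
      mateL pX.coevaluation' pZ.evaluation' (f ≫ g) :=
  (@comp_rightAdjointMate C _ _ X Y Z ⟨X'⟩ ⟨Y'⟩ ⟨Z'⟩ f g).symm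

lemma mateL_id {X X' : C} (pX : ExactPairing X X') :
    mateL pX.coevaluation' pX.evaluation' (𝟙 X) = 𝟙 X' :=
  @rightAdjointMate_id C _ _ X ⟨X'⟩

lemma mateR_comp {X Y Z X' Y' Z' : C} (pX : ExactPairing X' X) (pY : ExactPairing Y' Y)
    (pZ : ExactPairing Z' Z) (f : X ⟶ Y) (g : Y ⟶ Z) :
    mateR pY.coevaluation' pZ.evaluation' g ≫ mateR pX.coevaluation' pY.evaluation' f =
      mateR pX.coevaluation' pZ.evaluation' (f ≫ g) :=
  (@comp_leftAdjointMate C _ _ X Y Z ⟨X'⟩ ⟨Y'⟩ ⟨Z'⟩ f g).symm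

variable [DualityData C]

/-- The evaluation of a tensor product obtained by nesting. -/
def evT (X Y : C) : (dual Y ⊗ dual X) ⊗ (X ⊗ Y) ⟶ 𝟙_ C :=
  𝟙 _ ⊗≫ dual Y ◁ (ev X ▷ Y) ⊗≫ ev Y

/-- The coevaluation of a tensor product obtained by nesting. -/
def coevT (X Y : C) : 𝟙_ C ⟶ (X ⊗ Y) ⊗ (dual Y ⊗ dual X) :=
  coev X ⊗≫ (X ◁ coev Y) ▷ dual X ⊗≫ 𝟙 _

/-- The right evaluation of a tensor product obtained by nesting. -/
def evRT (X Y : C) : (X ⊗ Y) ⊗ (dual Y ⊗ dual X) ⟶ 𝟙_ C :=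
  𝟙 _ ⊗≫ X ◁ (evR Y ▷ dual X) ⊗≫ evR X

/-- The right coevaluation of a tensor product obtained by nesting. -/
def coevRT (X Y : C) : 𝟙_ C ⟶ (dual Y ⊗ dual X) ⊗ (X ⊗ Y) :=
  coevR Y ⊗≫ (dual Y ◁ coevR X) ▷ Y ⊗≫ 𝟙 _

/-- The nested left duality. -/
abbrev leftT (X Y : C) : ExactPairing (X ⊗ Y) (dual Y ⊗ dual X) :=
  @ExactPairing.tensor C _ _ X Y (dual X) (dual Y) (DualityData.left X) (DualityData.left Y)

/-- The nested right duality. -/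
abbrev rightT (X Y : C) : ExactPairing (dual Y ⊗ dual X) (X ⊗ Y) :=
  @ExactPairing.tensor C _ _ (dual Y) (dual X) Y X (DualityData.right Y) (DualityData.right X)

/-- The left dual of `f`, with nested duality morphisms. -/
def leftNest {A B D E : C} (f : A ⊗ B ⟶ D ⊗ E) : dual E ⊗ dual D ⟶ dual B ⊗ dual A :=
  mateL (coevT A B) (evT D E) f

/-- The right dual of `f`, with nested duality morphisms. -/
def rightNest {A B D E : C} (f : A ⊗ B ⟶ D ⊗ E) : dual E ⊗ dual D ⟶ dual B ⊗ dual A :=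
  mateR (coevRT A B) (evRT D E) f

lemma leftConstraint_eq (X Y : C) :
    leftConstraint X Y = mateL (coev (Y ⊗ X)) (evT Y X) (𝟙 (Y ⊗ X)) := by
  unfold mateL leftConstraint evT
  monoidal

lemma rightConstraint_eq (X Y : C) :
    rightConstraint X Y = mateR (coevR (Y ⊗ X)) (evRT Y X) (𝟙 (Y ⊗ X)) := by
  unfold mateR rightConstraint evRT
  monoidal

lemma leftNest_comp {A B D E : C} (f : A ⊗ B ⟶ D ⊗ E) :
    leftNest f ≫ leftConstraint B A = leftConstraint E D ≫ leftDualMap f := by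
  have h1 := mateL_comp (DualityData.left (A ⊗ B)) (leftT A B) (leftT D E) (𝟙 _) f
  have h2 := mateL_comp (DualityData.left (A ⊗ B)) (DualityData.left (D ⊗ E)) (leftT D E) f (𝟙 _)
  rw [Category.id_comp] at h1
  rw [Category.comp_id] at h2
  rw [leftConstraint_eq, leftConstraint_eq]
  exact h1.trans h2.symm

lemma rightNest_comp {A B D E : C} (f : A ⊗ B ⟶ D ⊗ E) :
    rightNest f ≫ rightConstraint B A = rightConstraint E D ≫ rightDualMap f := by
  have h1 := mateR_comp (DualityData.right (A ⊗ B)) (rightT A B) (rightT D E) (𝟙 _) f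
  have h2 := mateR_comp (DualityData.right (A ⊗ B)) (DualityData.right (D ⊗ E)) (rightT D E) f (𝟙 _)
  rw [Category.id_comp] at h1
  rw [Category.comp_id] at h2
  rw [rightConstraint_eq, rightConstraint_eq]
  exact h1.trans h2.symm

lemma mono_leftConstraint (X Y : C) : Mono (leftConstraint X Y) := by
  have h1 := mateL_comp (leftT Y X) (DualityData.left (Y ⊗ X)) (leftT Y X) (𝟙 _) (𝟙 _)
  rw [Category.id_comp, mateL_id] at h1
  rw [leftConstraint_eq]
  exact SplitMono.mono ⟨mateL (coevT Y X) (ev (Y ⊗ X)) (𝟙 (Y ⊗ X)), h1⟩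

end Nested

section
variable {C : Type u} [Category.{v} C] [MonoidalCategory C] [PivotalCategory C]

lemma nest_eq {A B D E : C} (f : A ⊗ B ⟶ D ⊗ E) : leftNest f = rightNest f := by
  have := mono_leftConstraint B A
  rw [← cancel_mono (leftConstraint B A), leftNest_comp, PivotalCategory.map_eq,
    PivotalCategory.constraint_eq, PivotalCategory.constraint_eq, rightNest_comp]
end
section
variable {C : Type u} [Category.{v} C] [MonoidalCategory C] [DualityData C]

lemma leftNest_def {A B D E : C} (f : A ⊗ B ⟶ D ⊗ E) :
    leftNest f = 𝟙 _ ⊗≫ (dual E ⊗ dual D) ◁ coev A ⊗≫ (dual E ⊗ dual D ⊗ A) ◁ coev B ▷ dual A ⊗≫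
      (dual E ⊗ dual D) ◁ f ▷ (dual B ⊗ dual A) ⊗≫ dual E ◁ ev D ▷ (E ⊗ dual B ⊗ dual A) ⊗≫
      ev E ▷ (dual B ⊗ dual A) ⊗≫ 𝟙 _ := by
  unfold leftNest mateL evT coevT
  monoidal

lemma rightNest_def {A B D E : C} (f : A ⊗ B ⟶ D ⊗ E) :
    rightNest f = 𝟙 _ ⊗≫ coevR B ▷ (dual E ⊗ dual D) ⊗≫ dual B ◁ coevR A ▷ (B ⊗ dual E ⊗ dual D) ⊗≫
      (dual B ⊗ dual A) ◁ f ▷ (dual E ⊗ dual D) ⊗≫ (dual B ⊗ dual A ⊗ D) ◁ evR E ▷ dual D ⊗≫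
      (dual B ⊗ dual A) ◁ evR D ⊗≫ 𝟙 _ := by
  unfold rightNest mateR evRT coevRT
  monoidal

end
end TV

namespace TV
section Triangles
variable {C : Type u} [Category.{v} C] [MonoidalCategory C] [DualityData C]

lemma tri1 (X : C) : coev X ▷ X ⊗≫ X ◁ ev X = ⊗𝟙.hom :=
  @ExactPairing.evaluation_coevaluation'' C _ _ X (dual X) (DualityData.left X)

lemma tri2 (X : C) : dual X ◁ coev X ⊗≫ ev X ▷ dual X = ⊗𝟙.hom :=
  @ExactPairing.coevaluation_evaluation'' C _ _ X (dual X) (DualityData.left X)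

lemma tri3 (X : C) : coevR X ▷ dual X ⊗≫ dual X ◁ evR X = ⊗𝟙.hom :=
  @ExactPairing.evaluation_coevaluation'' C _ _ (dual X) X (DualityData.right X)

lemma tri4 (X : C) : X ◁ coevR X ⊗≫ evR X ▷ X = ⊗𝟙.hom :=
  @ExactPairing.coevaluation_evaluation'' C _ _ (dual X) X (DualityData.right X)

end Triangles

section Lax
variable {C : Type u} [Category.{v} C] [MonoidalCategory C]

/-- A half braiding whose components need not be invertible. -/
structure LaxHalf (P : ObjectProperty C) [P.IsMonoidal] (B : C) where
  s (U : C) (hU : P U) : B ⊗ U ⟶ U ⊗ B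
  nat {U V : C} (hU : P U) (hV : P V) (f : U ⟶ V) : B ◁ f ≫ s V hV = s U hU ≫ f ▷ B
  mul (U V : C) (hU : P U) (hV : P V) :
    s (U ⊗ V) (P.prop_tensor hU hV) =
      (α_ _ _ _).inv ≫ s U hU ▷ V ≫ (α_ _ _ _).hom ≫ U ◁ s V hV ≫ (α_ _ _ _).inv
  one : s (𝟙_ C) P.prop_unit = (ρ_ B).hom ≫ (λ_ B).inv

variable {P : ObjectProperty C} [P.IsMonoidal] {B : C}

/-- The candidate for the inverse of the component at `V`. -/
def LaxHalf.rot (b : LaxHalf P B) {V W : C} (hW : P W) (c : 𝟙_ C ⟶ W ⊗ V)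
    (e : V ⊗ W ⟶ 𝟙_ C) : V ⊗ B ⟶ B ⊗ V :=
  𝟙 _ ⊗≫ (V ⊗ B) ◁ c ⊗≫ V ◁ b.s W hW ▷ V ⊗≫ e ▷ (B ⊗ V) ⊗≫ 𝟙 _

lemma LaxHalf.comp_rot (b : LaxHalf P B) {V W : C} (hV : P V) (hW : P W) (c : 𝟙_ C ⟶ W ⊗ V)
    (e : V ⊗ W ⟶ 𝟙_ C) (h : V ◁ c ⊗≫ e ▷ V = ⊗𝟙.hom) : b.s V hV ≫ b.rot hW c e = 𝟙 _ := by
  unfold LaxHalf.rot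
  calc
    _ = 𝟙 _ ⊗≫ (b.s V hV ▷ 𝟙_ C ≫ (V ⊗ B) ◁ c) ⊗≫ V ◁ b.s W hW ▷ V ⊗≫ e ▷ (B ⊗ V) ⊗≫ 𝟙 _ := by
        monoidal
    _ = 𝟙 _ ⊗≫ (B ⊗ V) ◁ c ⊗≫ (((α_ _ _ _).inv ≫ b.s V hV ▷ W ≫ (α_ _ _ _).hom ≫ V ◁ b.s W hW ≫
          (α_ _ _ _).inv) ≫ e ▷ B) ▷ V ⊗≫ 𝟙 _ := by
        rw [← whisker_exchange]; monoidal
    _ = 𝟙 _ ⊗≫ B ◁ (V ◁ c ⊗≫ e ▷ V) ⊗≫ 𝟙 _ := by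
        rw [← b.mul V W hV hW, ← b.nat _ P.prop_unit, b.one]; monoidal
    _ = 𝟙 _ := by rw [h]; monoidal

lemma LaxHalf.rot_comp (b : LaxHalf P B) {V W : C} (hV : P V) (hW : P W) (c : 𝟙_ C ⟶ W ⊗ V)
    (e : V ⊗ W ⟶ 𝟙_ C) (h : V ◁ c ⊗≫ e ▷ V = ⊗𝟙.hom) : b.rot hW c e ≫ b.s V hV = 𝟙 _ := by
  unfold LaxHalf.rot
  calc
    _ = 𝟙 _ ⊗≫ (V ⊗ B) ◁ c ⊗≫ V ◁ b.s W hW ▷ V ⊗≫ (e ▷ (B ⊗ V) ≫ 𝟙_ C ◁ b.s V hV) ⊗≫ 𝟙 _ := by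
        monoidal
    _ = 𝟙 _ ⊗≫ V ◁ (B ◁ c ≫ ((α_ _ _ _).inv ≫ b.s W hW ▷ V ≫ (α_ _ _ _).hom ≫ W ◁ b.s V hV ≫
          (α_ _ _ _).inv)) ⊗≫ e ▷ (V ⊗ B) ⊗≫ 𝟙 _ := by
        rw [← whisker_exchange]; monoidal
    _ = 𝟙 _ ⊗≫ (V ◁ c ⊗≫ e ▷ V) ▷ B ⊗≫ 𝟙 _ := by
        rw [← b.mul W V hW hV, b.nat P.prop_unit, b.one]; monoidal
    _ = 𝟙 _ := by rw [h]; monoidal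

/-- The half braiding at the unit object. -/
lemma RelHalfBraiding.one (b : RelHalfBraiding P B) :
    (b.β (𝟙_ C) P.prop_unit).hom = (ρ_ B).hom ≫ (λ_ B).inv := by
  have h := b.naturality (P.prop_tensor P.prop_unit P.prop_unit) P.prop_unit (λ_ (𝟙_ C)).hom
  rw [b.monoidal _ _ P.prop_unit P.prop_unit] at h
  have h2 : (b.β (𝟙_ C) P.prop_unit).hom ≫ ((λ_ B).hom ≫ (ρ_ B).inv) ≫
      (b.β (𝟙_ C) P.prop_unit).hom = (b.β (𝟙_ C) P.prop_unit).hom ≫ 𝟙 _ := by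
    calc
      _ = 𝟙 _ ⊗≫ (((α_ _ _ _).inv ≫ (b.β (𝟙_ C) P.prop_unit).hom ▷ 𝟙_ C ≫ (α_ _ _ _).hom ≫
            𝟙_ C ◁ (b.β (𝟙_ C) P.prop_unit).hom ≫ (α_ _ _ _).inv) ≫ (λ_ (𝟙_ C)).hom ▷ B) ⊗≫
              𝟙 _ := by monoidal
      _ = _ := by rw [← h]; monoidal
  rw [cancel_epi] at h2
  rw [← cancel_epi ((λ_ B).hom ≫ (ρ_ B).inv), h2]
  simp

/-- A half braiding as a lax half braiding. -/
def RelHalfBraiding.toLax (b : RelHalfBraiding P B) : LaxHalf P B where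
  s U hU := (b.β U hU).hom
  nat := b.naturality
  mul := b.monoidal
  one := b.one

/-- Naturality of the inverse half braiding. -/
lemma RelHalfBraiding.inv_nat (b : RelHalfBraiding P B) {U V : C} (hU : P U) (hV : P V)
    (f : U ⟶ V) : f ▷ B ≫ (b.β V hV).inv = (b.β U hU).inv ≫ B ◁ f := by
  rw [Iso.comp_inv_eq, Category.assoc, b.naturality hU hV, Iso.inv_hom_id_assoc]

/-- Multiplicativity of the inverse half braiding. -/
lemma RelHalfBraiding.inv_mul (b : RelHalfBraiding P B) {U V : C} (hU : P U) (hV : P V) :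
    (b.β (U ⊗ V) (P.prop_tensor hU hV)).inv =
      (α_ _ _ _).hom ≫ U ◁ (b.β V hV).inv ≫ (α_ _ _ _).inv ≫ (b.β U hU).inv ▷ V ≫
        (α_ _ _ _).hom := by
  rw [← cancel_epi (b.β (U ⊗ V) (P.prop_tensor hU hV)).hom, Iso.hom_inv_id,
    b.monoidal _ _ hU hV]
  simp

/-- The inverse half braiding at the unit object. -/
lemma RelHalfBraiding.inv_one (b : RelHalfBraiding P B) :
    (b.β (𝟙_ C) P.prop_unit).inv = (λ_ B).hom ≫ (ρ_ B).inv := by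
  rw [← cancel_epi (b.β (𝟙_ C) P.prop_unit).hom, Iso.hom_inv_id, b.one]
  simp

end Lax

section DualHalf
variable {C : Type u} [Category.{v} C] [MonoidalCategory C] [DualityData C]
variable {P : ObjectProperty C} [P.IsMonoidal] {A : C}

/-- `σ†_U : A^* ⊗ U ⟶ U ⊗ A^*`, obtained from the inverse of `σ_U`. -/
def dualHom (b : RelHalfBraiding P A) (U : C) (hU : P U) : dual A ⊗ U ⟶ U ⊗ dual A :=
  𝟙 _ ⊗≫ (dual A ⊗ U) ◁ coev A ⊗≫ dual A ◁ (b.β U hU).inv ▷ dual A ⊗≫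
    ev A ▷ (U ⊗ dual A) ⊗≫ 𝟙 _

/-- The inverse of `σ†_U`. -/
def dualInv (b : RelHalfBraiding P A) (U : C) (hU : P U) : U ⊗ dual A ⟶ dual A ⊗ U :=
  𝟙 _ ⊗≫ coevR A ▷ (U ⊗ dual A) ⊗≫ dual A ◁ (b.β U hU).hom ▷ dual A ⊗≫
    (dual A ⊗ U) ◁ evR A ⊗≫ 𝟙 _

lemma dualHom_ev (b : RelHalfBraiding P A) (U : C) (hU : P U) :
    dualHom b U hU ▷ A ⊗≫ U ◁ ev A = 𝟙 _ ⊗≫ dual A ◁ (b.β U hU).inv ⊗≫ ev A ▷ U ⊗≫ 𝟙 _ := by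
  unfold dualHom
  calc
    _ = 𝟙 _ ⊗≫ (dual A ⊗ U) ◁ coev A ▷ A ⊗≫ ((dual A ◁ (b.β U hU).inv ⊗≫
          ev A ▷ U) ▷ (dual A ⊗ A) ≫ (𝟙_ C ⊗ U) ◁ ev A) ⊗≫ 𝟙 _ := by monoidal
    _ = 𝟙 _ ⊗≫ (dual A ⊗ U) ◁ (coev A ▷ A ⊗≫ A ◁ ev A) ⊗≫ dual A ◁ (b.β U hU).inv ⊗≫
          ev A ▷ U ⊗≫ 𝟙 _ := by rw [← whisker_exchange]; monoidal
    _ = _ := by rw [tri1]; monoidal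

lemma coev_dualHom (b : RelHalfBraiding P A) (U : C) (hU : P U) :
    coev A ▷ U ⊗≫ A ◁ dualHom b U hU =
      𝟙 _ ⊗≫ U ◁ coev A ⊗≫ (b.β U hU).inv ▷ dual A ⊗≫ 𝟙 _ := by
  unfold dualHom
  calc
    _ = 𝟙 _ ⊗≫ (coev A ▷ (U ⊗ 𝟙_ C) ≫ (A ⊗ dual A) ◁ (U ◁ coev A ⊗≫ (b.β U hU).inv ▷ dual A)) ⊗≫
          A ◁ ev A ▷ (U ⊗ dual A) ⊗≫ 𝟙 _ := by monoidal
    _ = 𝟙 _ ⊗≫ U ◁ coev A ⊗≫ (b.β U hU).inv ▷ dual A ⊗≫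
          (coev A ▷ A ⊗≫ A ◁ ev A) ▷ (U ⊗ dual A) ⊗≫ 𝟙 _ := by
        rw [← whisker_exchange]; monoidal
    _ = _ := by rw [tri1]; monoidal

lemma dualInv_evR (b : RelHalfBraiding P A) (U : C) (hU : P U) :
    A ◁ dualInv b U hU ⊗≫ evR A ▷ U =
      𝟙 _ ⊗≫ (b.β U hU).hom ▷ dual A ⊗≫ U ◁ evR A ⊗≫ 𝟙 _ := by
  unfold dualInv
  calc
    _ = 𝟙 _ ⊗≫ A ◁ coevR A ▷ (U ⊗ dual A) ⊗≫ ((A ⊗ dual A) ◁ ((b.β U hU).hom ▷ dual A ⊗≫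
          U ◁ evR A) ≫ evR A ▷ (U ⊗ 𝟙_ C)) ⊗≫ 𝟙 _ := by monoidal
    _ = 𝟙 _ ⊗≫ (A ◁ coevR A ⊗≫ evR A ▷ A) ▷ (U ⊗ dual A) ⊗≫ (b.β U hU).hom ▷ dual A ⊗≫
          U ◁ evR A ⊗≫ 𝟙 _ := by rw [whisker_exchange]; monoidal
    _ = _ := by rw [tri4]; monoidal

lemma coevR_dualInv (b : RelHalfBraiding P A) (U : C) (hU : P U) :
    U ◁ coevR A ⊗≫ dualInv b U hU ▷ A =
      𝟙 _ ⊗≫ coevR A ▷ U ⊗≫ dual A ◁ (b.β U hU).hom ⊗≫ 𝟙 _ := by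
  unfold dualInv
  calc
    _ = 𝟙 _ ⊗≫ ((𝟙_ C ⊗ U) ◁ coevR A ≫ (coevR A ▷ U ⊗≫ dual A ◁ (b.β U hU).hom) ▷ (dual A ⊗ A)) ⊗≫
          (dual A ⊗ U) ◁ evR A ▷ A ⊗≫ 𝟙 _ := by monoidal
    _ = 𝟙 _ ⊗≫ coevR A ▷ U ⊗≫ dual A ◁ (b.β U hU).hom ⊗≫
          (dual A ⊗ U) ◁ (A ◁ coevR A ⊗≫ evR A ▷ A) ⊗≫ 𝟙 _ := by
        rw [whisker_exchange]; monoidal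
    _ = _ := by rw [tri4]; monoidal

/-- The family `σ†` as a lax half braiding. -/
def dualLax (b : RelHalfBraiding P A) : LaxHalf P (dual A) where
  s := dualHom b
  nat {U V} hU hV f := by
    unfold dualHom
    calc
      _ = 𝟙 _ ⊗≫ dual A ◁ (f ▷ 𝟙_ C ≫ V ◁ coev A) ⊗≫ dual A ◁ (b.β V hV).inv ▷ dual A ⊗≫
            ev A ▷ (V ⊗ dual A) ⊗≫ 𝟙 _ := by monoidal
      _ = 𝟙 _ ⊗≫ dual A ◁ U ◁ coev A ⊗≫ dual A ◁ (f ▷ A ≫ (b.β V hV).inv) ▷ dual A ⊗≫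
            ev A ▷ (V ⊗ dual A) ⊗≫ 𝟙 _ := by rw [← whisker_exchange]; monoidal
      _ = 𝟙 _ ⊗≫ dual A ◁ U ◁ coev A ⊗≫ dual A ◁ (b.β U hU).inv ▷ dual A ⊗≫
            ((dual A ⊗ A) ◁ f ≫ ev A ▷ V) ▷ dual A ⊗≫ 𝟙 _ := by
          rw [b.inv_nat hU hV]; monoidal
      _ = _ := by rw [whisker_exchange]; monoidal
  mul U V hU hV := by
    symm
    calc
      _ = 𝟙 _ ⊗≫ (dualHom b U hU ▷ (V ⊗ 𝟙_ C) ≫ (U ⊗ dual A) ◁ (V ◁ coev A ⊗≫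
            (b.β V hV).inv ▷ dual A)) ⊗≫ U ◁ ev A ▷ (V ⊗ dual A) ⊗≫ 𝟙 _ := by
          conv_lhs => enter [2, 2, 2, 1]; unfold dualHom
          monoidal
      _ = 𝟙 _ ⊗≫ (dual A ⊗ U) ◁ (V ◁ coev A ⊗≫ (b.β V hV).inv ▷ dual A) ⊗≫
            (dualHom b U hU ▷ A ⊗≫ U ◁ ev A) ▷ (V ⊗ dual A) ⊗≫ 𝟙 _ := by
          rw [← whisker_exchange]; monoidal
      _ = _ := by
          rw [dualHom_ev]
          unfold dualHom
          rw [b.inv_mul hU hV]; monoidal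
  one := by
    unfold dualHom
    calc
      _ = 𝟙 _ ⊗≫ (dual A ◁ coev A ⊗≫ ev A ▷ dual A) ⊗≫ 𝟙 _ := by rw [b.inv_one]; monoidal
      _ = _ := by rw [tri2]; monoidal

lemma inv_eq_rot (b : RelHalfBraiding P A) {U : C} (hU : P U) (hU' : P (dual U)) :
    (b.β (dual U) hU').inv = b.toLax.rot hU (coev U) (ev U) := by
  have h := b.toLax.comp_rot hU' hU (coev U) (ev U) (tri2 U)
  rw [← cancel_epi (b.β (dual U) hU').hom, Iso.hom_inv_id]
  exact h.symm

lemma dualHom_dual (b : RelHalfBraiding P A) {U : C} (hU : P U) (hU' : P (dual U)) :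
    dualHom b (dual U) hU' = leftNest (b.β U hU).hom := by
  unfold dualHom
  rw [inv_eq_rot b hU hU', leftNest_def]
  change 𝟙 _ ⊗≫ (dual A ⊗ dual U) ◁ coev A ⊗≫ dual A ◁ (𝟙 _ ⊗≫ (dual U ⊗ A) ◁ coev U ⊗≫
    dual U ◁ (b.β U hU).hom ▷ dual U ⊗≫ ev U ▷ (A ⊗ dual U) ⊗≫ 𝟙 _) ▷ dual A ⊗≫
    ev A ▷ (dual U ⊗ dual A) ⊗≫ 𝟙 _ = _
  monoidal

lemma rot_rightNest (b : RelHalfBraiding P A) {U : C} (hU : P U) :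
    (𝟙 _ ⊗≫ (U ⊗ dual A) ◁ coevR U ⊗≫ U ◁ rightNest (b.β U hU).hom ▷ U ⊗≫
      evR U ▷ (dual A ⊗ U) ⊗≫ 𝟙 _ : U ⊗ dual A ⟶ dual A ⊗ U) = dualInv b U hU := by
  have key : rightNest (b.β U hU).hom = 𝟙 _ ⊗≫ coevR U ▷ (dual A ⊗ dual U) ⊗≫
      dual U ◁ dualInv b U hU ▷ dual U ⊗≫ (dual U ⊗ dual A) ◁ evR U ⊗≫ 𝟙 _ := by
    rw [rightNest_def]
    unfold dualInv
    monoidal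
  rw [key]
  calc
    _ = 𝟙 _ ⊗≫ U ◁ ((𝟙_ C ⊗ dual A) ◁ coevR U ≫ (coevR U ▷ dual A ⊗≫ dual U ◁ dualInv b U hU) ▷
            (dual U ⊗ U)) ⊗≫ (U ⊗ dual U ⊗ dual A) ◁ evR U ▷ U ⊗≫
            evR U ▷ (dual A ⊗ U) ⊗≫ 𝟙 _ := by monoidal
    _ = 𝟙 _ ⊗≫ U ◁ (coevR U ▷ dual A ⊗≫ dual U ◁ dualInv b U hU) ⊗≫
            (U ⊗ dual U ⊗ dual A) ◁ (U ◁ coevR U ⊗≫ evR U ▷ U) ⊗≫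
            evR U ▷ (dual A ⊗ U) ⊗≫ 𝟙 _ := by rw [whisker_exchange]; monoidal
    _ = 𝟙 _ ⊗≫ U ◁ coevR U ▷ dual A ⊗≫ ((U ⊗ dual U) ◁ dualInv b U hU ≫
            evR U ▷ (dual A ⊗ U)) ⊗≫ 𝟙 _ := by rw [tri4]; monoidal
    _ = 𝟙 _ ⊗≫ (U ◁ coevR U ⊗≫ evR U ▷ U) ▷ dual A ⊗≫ dualInv b U hU ⊗≫ 𝟙 _ := by
        rw [whisker_exchange]; monoidal
    _ = _ := by rw [tri4]; monoidal

end DualHalf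

section
variable {C : Type u} [Category.{v} C] [MonoidalCategory C] [PivotalCategory C]
variable {P : ObjectProperty C} [P.IsMonoidal] {A : C}

lemma dualLax_rot (b : RelHalfBraiding P A) {U : C} (hU : P U) (hU' : P (dual U)) :
    (dualLax b).rot hU' (coevR U) (evR U) = dualInv b U hU := by
  rw [← rot_rightNest, ← nest_eq, ← dualHom_dual b hU hU']
  rfl

/-- A class of objects stable under duality. -/
class DualStable (P : ObjectProperty C) : Prop where
  prop_dual {X : C} (hX : P X) : P (dual X)

/-- The dual half braiding `σ†`. -/
def dualHalf [DualStable P] (b : RelHalfBraiding P A) : RelHalfBraiding P (dual A) where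
  β U hU :=
    { hom := dualHom b U hU
      inv := dualInv b U hU
      hom_inv_id := by
        have h := (dualLax b).comp_rot hU (DualStable.prop_dual hU) (coevR U) (evR U) (tri4 U)
        rw [dualLax_rot] at h
        exact h
      inv_hom_id := by
        have h := (dualLax b).rot_comp hU (DualStable.prop_dual hU) (coevR U) (evR U) (tri4 U)
        rw [dualLax_rot] at h
        exact h }
  naturality := (dualLax b).nat
  monoidal := (dualLax b).mul

namespace RelCenter
variable [DualStable P]

/-- The dual `(A^*, σ†)` of `(A, σ)`. -/
def dualObj (A : RelCenter P) : RelCenter P := ⟨dual A.pt, dualHalf A.half⟩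

lemma ev_comm (A : RelCenter P) (U : C) (hU : P U) :
    ev A.pt ▷ U ≫ (𝟙_ (RelCenter P)).σ U hU = (dualObj A ⊗ A).σ U hU ≫ U ◁ ev A.pt := by
  change ev A.pt ▷ U ≫ (λ_ U).hom ≫ (ρ_ U).inv = ((α_ _ _ _).hom ≫
    dual A.pt ◁ A.σ U hU ≫ (α_ _ _ _).inv ≫ dualHom A.half U hU ▷ A.pt ≫ (α_ _ _ _).hom) ≫
      U ◁ ev A.pt
  symm
  calc
    _ = 𝟙 _ ⊗≫ dual A.pt ◁ A.σ U hU ⊗≫ (dualHom A.half U hU ▷ A.pt ⊗≫ U ◁ ev A.pt) ⊗≫ 𝟙 _ := by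
        monoidal
    _ = 𝟙 _ ⊗≫ dual A.pt ◁ ((A.half.β U hU).hom ≫ (A.half.β U hU).inv) ⊗≫ ev A.pt ▷ U ⊗≫ 𝟙 _ := by
        rw [dualHom_ev]; monoidal
    _ = _ := by rw [Iso.hom_inv_id]; monoidal

lemma coev_comm (A : RelCenter P) (U : C) (hU : P U) :
    coev A.pt ▷ U ≫ (A ⊗ dualObj A).σ U hU = (𝟙_ (RelCenter P)).σ U hU ≫ U ◁ coev A.pt := by
  change coev A.pt ▷ U ≫ ((α_ _ _ _).hom ≫
    A.pt ◁ dualHom A.half U hU ≫ (α_ _ _ _).inv ≫ A.σ U hU ▷ dual A.pt ≫ (α_ _ _ _).hom) =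
      ((λ_ U).hom ≫ (ρ_ U).inv) ≫ U ◁ coev A.pt
  calc
    _ = 𝟙 _ ⊗≫ (coev A.pt ▷ U ⊗≫ A.pt ◁ dualHom A.half U hU) ⊗≫ A.σ U hU ▷ dual A.pt ⊗≫ 𝟙 _ := by
        monoidal
    _ = 𝟙 _ ⊗≫ U ◁ coev A.pt ⊗≫ ((A.half.β U hU).inv ≫ (A.half.β U hU).hom) ▷ dual A.pt ⊗≫
          𝟙 _ := by
        rw [coev_dualHom]; monoidal
    _ = _ := by rw [Iso.inv_hom_id]; monoidal

lemma evR_comm (A : RelCenter P) (U : C) (hU : P U) :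
    evR A.pt ▷ U ≫ (𝟙_ (RelCenter P)).σ U hU = (A ⊗ dualObj A).σ U hU ≫ U ◁ evR A.pt := by
  change evR A.pt ▷ U ≫ (λ_ U).hom ≫ (ρ_ U).inv = ((α_ _ _ _).hom ≫
    A.pt ◁ dualHom A.half U hU ≫ (α_ _ _ _).inv ≫ A.σ U hU ▷ dual A.pt ≫ (α_ _ _ _).hom) ≫
      U ◁ evR A.pt
  symm
  calc
    _ = 𝟙 _ ⊗≫ A.pt ◁ dualHom A.half U hU ⊗≫ (𝟙 (A.pt ⊗ U ⊗ dual A.pt) ⊗≫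
          A.σ U hU ▷ dual A.pt ⊗≫ U ◁ evR A.pt ⊗≫ 𝟙 (𝟙_ C ⊗ U)) ⊗≫ 𝟙 _ := by monoidal
    _ = 𝟙 _ ⊗≫ A.pt ◁ (((dualHalf A.half).β U hU).hom ≫ ((dualHalf A.half).β U hU).inv) ⊗≫
          evR A.pt ▷ U ⊗≫ 𝟙 _ := by
        rw [← dualInv_evR]
        change _ = 𝟙 _ ⊗≫ A.pt ◁ (dualHom A.half U hU ≫ dualInv A.half U hU) ⊗≫
          evR A.pt ▷ U ⊗≫ 𝟙 _
        monoidal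
    _ = _ := by rw [Iso.hom_inv_id]; monoidal

lemma coevR_comm (A : RelCenter P) (U : C) (hU : P U) :
    coevR A.pt ▷ U ≫ (dualObj A ⊗ A).σ U hU = (𝟙_ (RelCenter P)).σ U hU ≫ U ◁ coevR A.pt := by
  change coevR A.pt ▷ U ≫ ((α_ _ _ _).hom ≫
    dual A.pt ◁ A.σ U hU ≫ (α_ _ _ _).inv ≫ dualHom A.half U hU ▷ A.pt ≫ (α_ _ _ _).hom) =
      ((λ_ U).hom ≫ (ρ_ U).inv) ≫ U ◁ coevR A.pt
  calc
    _ = 𝟙 _ ⊗≫ (𝟙 (U ⊗ 𝟙_ C) ⊗≫ coevR A.pt ▷ U ⊗≫ dual A.pt ◁ A.σ U hU ⊗≫ 𝟙 ((dual A.pt ⊗ U) ⊗ A.pt)) ⊗≫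
          dualHom A.half U hU ▷ A.pt ⊗≫ 𝟙 _ := by monoidal
    _ = 𝟙 _ ⊗≫ U ◁ coevR A.pt ⊗≫ (((dualHalf A.half).β U hU).inv ≫
          ((dualHalf A.half).β U hU).hom) ▷ A.pt ⊗≫ 𝟙 _ := by
        rw [← coevR_dualInv]
        change _ = 𝟙 _ ⊗≫ U ◁ coevR A.pt ⊗≫ (dualInv A.half U hU ≫
          dualHom A.half U hU) ▷ A.pt ⊗≫ 𝟙 _
        monoidal
    _ = _ := by rw [Iso.inv_hom_id]; monoidal

/-- The duality of the relative center lifts that of `C`. -/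
instance : DualityData (RelCenter P) where
  dual := dualObj
  left A :=
    { coevaluation' := ⟨coev A.pt, coev_comm A⟩
      evaluation' := ⟨ev A.pt, ev_comm A⟩
      coevaluation_evaluation' := by
        apply hom_ext
        exact (DualityData.left A.pt).coevaluation_evaluation'
      evaluation_coevaluation' := by
        apply hom_ext
        exact (DualityData.left A.pt).evaluation_coevaluation' }
  right A :=
    { coevaluation' := ⟨coevR A.pt, coevR_comm A⟩
      evaluation' := ⟨evR A.pt, evR_comm A⟩
      coevaluation_evaluation' := by
        apply hom_ext
        exact (DualityData.right A.pt).coevaluation_evaluation'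
      evaluation_coevaluation' := by
        apply hom_ext
        exact (DualityData.right A.pt).evaluation_coevaluation' }

/-- The pivotal structure of the relative center. -/
instance : PivotalCategory (RelCenter P) where
  map_eq f := by
    apply hom_ext
    exact PivotalCategory.map_eq (Hom.f f)
  constraint_eq A B := by
    apply hom_ext
    exact PivotalCategory.constraint_eq A.pt B.pt
  unitConstraint_eq := by
    apply hom_ext
    exact PivotalCategory.unitConstraint_eq (C := C)

end RelCenter

end
end TV

namespace TV

namespace RelCenter

section Additive
variable {C : Type u} [Category.{v} C] [MonoidalCategory C] [Preadditive C]
  [MonoidalPreadditive C] {P : ObjectProperty C} [P.IsMonoidal]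

instance (A B : RelCenter P) : Zero (A ⟶ B) := ⟨⟨0, fun U hU => by simp⟩⟩

instance (A B : RelCenter P) : Add (A ⟶ B) :=
  ⟨fun f g => ⟨Hom.f f + Hom.f g, fun U hU => by simp [hom_comm]⟩⟩

instance (A B : RelCenter P) : Neg (A ⟶ B) :=
  ⟨fun f => ⟨-Hom.f f, fun U hU => by
    have h1 : (-Hom.f f) ▷ U = -(Hom.f f ▷ U) := ((tensorRight U).map_neg (f := Hom.f f))
    have h2 : U ◁ (-Hom.f f) = -(U ◁ Hom.f f) := ((tensorLeft U).map_neg (f := Hom.f f))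
    rw [h1, h2, Preadditive.neg_comp, Preadditive.comp_neg, hom_comm]⟩⟩

@[simp] lemma zero_f (A B : RelCenter P) : Hom.f (0 : A ⟶ B) = 0 := rfl
@[simp] lemma add_f {A B : RelCenter P} (f g : A ⟶ B) : Hom.f (f + g) = Hom.f f + Hom.f g := rfl
@[simp] lemma neg_f {A B : RelCenter P} (f : A ⟶ B) : Hom.f (-f) = -Hom.f f := rfl

instance (A B : RelCenter P) : AddCommGroup (A ⟶ B) where
  add_assoc _ _ _ := hom_ext (add_assoc _ _ _)
  zero_add _ := hom_ext (zero_add _)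
  add_zero _ := hom_ext (add_zero _)
  add_comm _ _ := hom_ext (add_comm _ _)
  neg_add_cancel _ := hom_ext (neg_add_cancel _)
  nsmul := nsmulRec
  zsmul := zsmulRec

/-- Morphisms of the relative center are added as in `C`. -/
instance : Preadditive (RelCenter P) where
  add_comp _ _ _ _ _ _ := hom_ext (Preadditive.add_comp _ _ _ _ _ _)
  comp_add _ _ _ _ _ _ := hom_ext (Preadditive.comp_add _ _ _ _ _ _)

instance : MonoidalPreadditive (RelCenter P) where
  whiskerLeft_zero := hom_ext MonoidalPreadditive.whiskerLeft_zero
  zero_whiskerRight := hom_ext MonoidalPreadditive.zero_whiskerRight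
  whiskerLeft_add _ _ := hom_ext (MonoidalPreadditive.whiskerLeft_add _ _)
  add_whiskerRight _ _ := hom_ext (MonoidalPreadditive.add_whiskerRight _ _)

variable {𝕜 : Type w} [CommRing 𝕜] [Linear 𝕜 C] [MonoidalLinear 𝕜 C]

instance (A B : RelCenter P) : SMul 𝕜 (A ⟶ B) :=
  ⟨fun r f => ⟨r • Hom.f f, fun U hU => by simp [hom_comm]⟩⟩

@[simp] lemma smul_f {A B : RelCenter P} (r : 𝕜) (f : A ⟶ B) : Hom.f (r • f) = r • Hom.f f := rfl

instance (A B : RelCenter P) : Module 𝕜 (A ⟶ B) where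
  one_smul _ := hom_ext (one_smul _ _)
  mul_smul _ _ _ := hom_ext (mul_smul _ _ _)
  smul_zero _ := hom_ext (smul_zero _)
  smul_add _ _ _ := hom_ext (smul_add _ _ _)
  add_smul _ _ _ := hom_ext (add_smul _ _ _)
  zero_smul _ := hom_ext (zero_smul _ _)

/-- Morphisms of the relative center are multiplied by scalars as in `C`. -/
instance : Linear 𝕜 (RelCenter P) where
  smul_comp _ _ _ _ _ _ := hom_ext (Linear.smul_comp _ _ _ _ _ _)
  comp_smul _ _ _ _ _ _ := hom_ext (Linear.comp_smul _ _ _ _ _ _)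

instance : MonoidalLinear 𝕜 (RelCenter P) where
  whiskerLeft_smul _ _ _ _ _ := hom_ext (MonoidalLinear.whiskerLeft_smul _ _ _)
  smul_whiskerRight _ _ _ _ _ := hom_ext (MonoidalLinear.smul_whiskerRight _ _ _)

end Additive

end RelCenter

section Semisimple
variable {C : Type u} [Category.{v} C] [Preadditive C]

/-- `X` is a direct sum of the family `f`. -/
def IsDirectSum {ι : Type w} (X : C) (f : ι → C) : Prop :=
  ∃ b : Bicone f, Nonempty b.IsBilimit ∧ Nonempty (b.pt ≅ X)

variable (𝕜 : Type w) [CommRing 𝕜] [Linear 𝕜 C]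

/-- `X` is simple: `End X` is a free `𝕜`-module of rank one. -/
def IsSimpleObj (X : C) : Prop := Nonempty (𝕜 ≃ₗ[𝕜] (X ⟶ X))

variable (C) in
/-- Split semisimplicity: every object is a finite direct sum of simple objects, and there are no
nonzero morphisms between non-isomorphic simple objects. -/
structure IsSplitSemisimple : Prop where
  decomposes (X : C) : ∃ (n : ℕ) (f : Fin n → C), (∀ j, IsSimpleObj 𝕜 (f j)) ∧ IsDirectSum X f
  hom_eq_zero (X Y : C) : IsSimpleObj 𝕜 X → IsSimpleObj 𝕜 Y → IsEmpty (X ≅ Y) →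
    ∀ f : X ⟶ Y, f = 0

/-- The isomorphism classes of simple objects in the full subcategory with objects `P`. -/
def simpleClasses (P : ObjectProperty C) : Set (Quotient (isIsomorphicSetoid C)) :=
  {c | ∃ X : C, P X ∧ IsSimpleObj 𝕜 X ∧ Quotient.mk (isIsomorphicSetoid C) X = c}

/-- A simple object of the full subcategory with objects `P`, in a given isomorphism class. -/
def simpleRep (P : ObjectProperty C) (c : simpleClasses 𝕜 P) : C := c.2.choose

/-- The dimension `∑ dim_l(i) dim_r(i)` of the full subcategory with objects `P`; here `i` runs over
a representative set of simple objects of the subcategory, which is assumed to be finite. -/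
def dimension [MonoidalCategory C] [PivotalCategory C] (P : ObjectProperty C) : 𝟙_ C ⟶ 𝟙_ C :=
  ∑ᶠ c : simpleClasses 𝕜 P, dimL (simpleRep 𝕜 P c) ≫ dimR (simpleRep 𝕜 P c)

end Semisimple

section Graded
variable {C : Type u} [Category.{v} C] [MonoidalCategory C] [Preadditive C]
  {G : Type w'} [Group G]

/-- `grading α` is the class of objects of the full subcategory `C_α` of a `G`-graded category.
The subcategories are disjoint up to zero objects by `hom_eq_zero`. -/
class IsGGraded (grading : G → ObjectProperty C) : Prop where
  hasFiniteBiproducts : HasFiniteBiproducts C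
  additive (α : G) (n : ℕ) (f : Fin n → C) : (∀ j, grading α (f j)) →
    ∃ X, grading α X ∧ IsDirectSum X f
  splits (X : C) : ∃ (s : Finset G) (Y : G → C), (∀ α ∈ s, grading α (Y α)) ∧
    IsDirectSum X (fun α : s => Y α)
  tensor {α β : G} {X Y : C} : grading α X → grading β Y → grading (α * β) (X ⊗ Y)
  hom_eq_zero {α β : G} {X Y : C} : grading α X → grading β Y → α ≠ β → ∀ f : X ⟶ Y, f = 0
  unit : grading 1 (𝟙_ C)

/-- A pivotal `G`-graded category. The dual of an object of `C_α` is chosen in `C_{α⁻¹}`. -/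
class IsPivotalGraded [PivotalCategory C] (grading : G → ObjectProperty C) : Prop extends
    IsGGraded grading where
  dual_mem {α : G} {X : C} : grading α X → grading α⁻¹ (dual X)

instance (grading : G → ObjectProperty C) [h : IsGGraded grading] : (grading 1).IsMonoidal where
  prop_unit := h.unit
  prop_tensor _ _ hX hY := one_mul (1 : G) ▸ h.tensor hX hY

instance [PivotalCategory C] (grading : G → ObjectProperty C) [h : IsPivotalGraded grading] :
    DualStable (grading 1) where
  prop_dual hX := inv_one (G := G) ▸ h.dual_mem hX

/-- A `G`-fusion category. -/
structure IsGFusion (𝕜 : Type w) [CommRing 𝕜] [Linear 𝕜 C] [MonoidalPreadditive C]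
    [MonoidalLinear 𝕜 C] [PivotalCategory C] (grading : G → ObjectProperty C) : Prop extends
    IsPivotalGraded grading where
  unit_simple : IsSimpleObj 𝕜 (𝟙_ C)
  splitSemisimple : IsSplitSemisimple C 𝕜
  exists_simple (α : G) : ∃ X : C, grading α X ∧ IsSimpleObj 𝕜 X
  finite_simple (α : G) : (simpleClasses 𝕜 (grading α)).Finite

/-- The `G`-center: the center of `C` relative to `C_1`. -/
abbrev GCenter (grading : G → ObjectProperty C) [IsGGraded grading] := RelCenter (grading 1)

/-- The grading of the `G`-center: `Z_α(C)` consists of the half braidings `(A, σ)` with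
`A ∈ C_α`. -/
def centerGrading (grading : G → ObjectProperty C) [IsGGraded grading] :
    G → ObjectProperty (GCenter grading) := fun α A => grading α A.pt

end Graded

end TV

end

/-!
Semisimplicity of the center is a Maschke argument. A morphism `f : A ⟶ B` of `C` between half
braidings is averaged by encircling it with a closed loop coloured by each simple object `S i` of
`C_1`, pulled through the half braidings of `A` and `B`, with weight `dim_l (S i)`. The average is
a morphism of the center, averaging commutes with composition by such morphisms, and it multiplies
identities by `dim C_1 ≠ 0`. So a quasi-inverse in `C` of a morphism of the center averages to one
in the center. Idempotents of the center split because those of `C` do, and over an algebraically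
closed field quasi-inverses, split idempotents and finite-dimensional Hom-spaces give a
decomposition into simple objects.

Simple objects of `Z_α(C)` are controlled by the induced objects `⨁ i, (S i ⊗ X) ⊗ (S i)^*`. For
simple `X` in `C_α` these are nonzero, which gives existence. A nonzero morphism from `A` to `X` in
`C` yields a nonzero morphism of the center from `A` to the induced object, so that every simple
object of `Z_α(C)` is a summand of one of finitely many objects.

The category is graded by the `Z_α(C)` because braiding with objects of `C_1` preserves degrees, so
the projections of an object to its homogeneous components commute with its half braiding.
-/

noncomputable section

namespace TV

section Splitting
variable {C : Type u} [Category.{v} C] [Preadditive C]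

/-- A decomposition of the object `X` as the direct sum of the finite family `f`. Unlike for a
`Bicone`, the point `X` is a parameter, so that structure carried by a given object can be
transported to its summands and back. -/
structure Splitting {J : Type*} [Fintype J] (X : C) (f : J → C) where
  ι (j : J) : f j ⟶ X
  π (j : J) : X ⟶ f j
  ι_π_self (j : J) : ι j ≫ π j = 𝟙 (f j)
  ι_π_ne {j k : J} (h : j ≠ k) : ι j ≫ π k = 0
  total : ∑ j, π j ≫ ι j = 𝟙 X

namespace Splitting

attribute [simp] ι_π_self

variable {J : Type*} [Fintype J] {X Y : C} {f g : J → C}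

lemma hom_ext_right (s : Splitting X f) {Z : C} {a b : X ⟶ Z}
    (h : ∀ j, s.ι j ≫ a = s.ι j ≫ b) : a = b := by
  rw [← Category.id_comp a, ← Category.id_comp b, ← s.total]
  simp only [Preadditive.sum_comp, Category.assoc, h]

lemma hom_ext_left (s : Splitting X f) {Z : C} {a b : Z ⟶ X}
    (h : ∀ j, a ≫ s.π j = b ≫ s.π j) : a = b := by
  rw [← Category.comp_id a, ← Category.comp_id b, ← s.total]
  simp only [Preadditive.comp_sum, reassoc_of% h]

/-- The morphism into a direct sum with the given components. -/
def lift (s : Splitting X f) {Z : C} (a : ∀ j, Z ⟶ f j) : Z ⟶ X := ∑ j, a j ≫ s.ι j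

lemma lift_π (s : Splitting X f) {Z : C} (a : ∀ j, Z ⟶ f j) (j : J) :
    s.lift a ≫ s.π j = a j := by
  rw [lift, Preadditive.sum_comp, Finset.sum_eq_single j]
  · simp
  · intro k _ hk
    rw [Category.assoc, s.ι_π_ne hk, comp_zero]
  · simp

/-- The isomorphism between two direct sums whose components are the given isomorphisms. -/
def mapIso (s : Splitting X f) (t : Splitting Y g) (e : ∀ j, f j ≅ g j) : X ≅ Y where
  hom := t.lift fun j => s.π j ≫ (e j).hom
  inv := s.lift fun j => t.π j ≫ (e j).inv
  hom_inv_id := s.hom_ext_left fun j => by simp [lift_π, reassoc_of% lift_π]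
  inv_hom_id := t.hom_ext_left fun j => by simp [lift_π, reassoc_of% lift_π]

lemma mapIso_hom_π (s : Splitting X f) (t : Splitting Y g) (e : ∀ j, f j ≅ g j) (j : J) :
    (s.mapIso t e).hom ≫ t.π j = s.π j ≫ (e j).hom := t.lift_π _ j

lemma ι_mapIso_hom (s : Splitting X f) (t : Splitting Y g) (e : ∀ j, f j ≅ g j) (j : J) :
    s.ι j ≫ (s.mapIso t e).hom = (e j).hom ≫ t.ι j := t.hom_ext_left fun k => by
  rw [Category.assoc, mapIso_hom_π]
  by_cases h : j = k
  · subst h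
    simp [reassoc_of% s.ι_π_self]
  · simp [reassoc_of% s.ι_π_ne h, t.ι_π_ne h]

/-- The inclusion and the projection of a summand. -/
def retract (s : Splitting X f) (j : J) : Retract (f j) X := ⟨s.ι j, s.π j, s.ι_π_self j⟩

/-- The splitting of an object with zero identity into the empty family. -/
def empty (h : 𝟙 X = 0) (f : PEmpty → C) : Splitting X f where
  ι j := j.elim
  π j := j.elim
  ι_π_self j := j.elim
  ι_π_ne {j} := j.elim
  total := by simp [h]

/-- The splitting of an object into itself. -/
def single (X : C) : Splitting X (fun _ : Unit => X) where
  ι _ := 𝟙 X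
  π _ := 𝟙 X
  ι_π_self _ := by simp
  ι_π_ne h := (h rfl).elim
  total := by simp

/-- The summands `f j` of a splitting replaced by the summands of given splittings of them. -/
def sigma {K : J → Type*} [∀ j, Fintype (K j)] {k : ∀ j, K j → C} (s : Splitting X f)
    (t : ∀ j, Splitting (f j) (k j)) : Splitting X (fun x : Σ j, K j => k x.1 x.2) where
  ι x := (t x.1).ι x.2 ≫ s.ι x.1
  π x := s.π x.1 ≫ (t x.1).π x.2
  ι_π_self x := by simp [reassoc_of% s.ι_π_self]
  ι_π_ne := by
    rintro ⟨j, x⟩ ⟨j', y⟩ h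
    by_cases hj : j = j'
    · subst hj
      have hxy : x ≠ y := fun hxy => h (by rw [hxy])
      simp [reassoc_of% s.ι_π_self, (t j).ι_π_ne hxy]
    · simp [reassoc_of% s.ι_π_ne hj]
  total := by
    rw [Fintype.sum_sigma, ← s.total]
    refine Finset.sum_congr rfl fun j _ => ?_
    rw [← Category.id_comp (s.ι j), ← (t j).total]
    simp [Preadditive.comp_sum, Preadditive.sum_comp]

/-- A splitting with its summands indexed by an equivalent type. -/
def reindex {K : Type*} [Fintype K] (s : Splitting X f) (e : K ≃ J) :
    Splitting X (fun k => f (e k)) where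
  ι k := s.ι (e k)
  π k := s.π (e k)
  ι_π_self k := s.ι_π_self _
  ι_π_ne h := s.ι_π_ne (e.injective.ne h)
  total := by rw [← s.total, ← e.sum_comp]

/-- The splitting of a biproduct into its summands. -/
def biproduct (f : J → C) [HasBiproduct f] : Splitting (⨁ f) f where
  ι := biproduct.ι f
  π := biproduct.π f
  ι_π_self j := by simp
  ι_π_ne h := biproduct.ι_π_ne f h
  total := IsBilimit.total (biproduct.isBilimit f)

open Classical in
/-- The bicone underlying a splitting. -/
def bicone (s : Splitting X f) : Bicone f where
  pt := X
  ι := s.ι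
  π := s.π
  ι_π j j' := by
    split_ifs with h
    · subst h
      simp
    · exact s.ι_π_ne h

lemma isDirectSum (s : Splitting X f) : IsDirectSum X f :=
  ⟨s.bicone, ⟨isBilimitOfTotal s.bicone s.total⟩, ⟨Iso.refl X⟩⟩

lemma hasBiproduct (s : Splitting X f) : HasBiproduct f :=
  hasBiproduct_of_total s.bicone s.total

section Monoidal
variable [MonoidalCategory C] [MonoidalPreadditive C] (s : Splitting X f) (U : C)

/-- The splitting of `U ⊗ X` induced by a splitting of `X`. -/
def whiskerLeft : Splitting (U ⊗ X) (fun j => U ⊗ f j) where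
  ι j := U ◁ s.ι j
  π j := U ◁ s.π j
  ι_π_self j := by simp [← MonoidalCategory.whiskerLeft_comp]
  ι_π_ne h := by simp [← MonoidalCategory.whiskerLeft_comp, s.ι_π_ne h]
  total := by simp [← MonoidalCategory.whiskerLeft_comp, ← whiskerLeft_sum, s.total]

/-- The splitting of `X ⊗ U` induced by a splitting of `X`. -/
def whiskerRight : Splitting (X ⊗ U) (fun j => f j ⊗ U) where
  ι j := s.ι j ▷ U
  π j := s.π j ▷ U
  ι_π_self j := by simp [← comp_whiskerRight]
  ι_π_ne h := by simp [← comp_whiskerRight, s.ι_π_ne h]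
  total := by simp [← comp_whiskerRight, ← sum_whiskerRight, s.total]

@[simp] lemma whiskerLeft_π (j : J) : (s.whiskerLeft U).π j = U ◁ s.π j := rfl
@[simp] lemma whiskerRight_ι (j : J) : (s.whiskerRight U).ι j = s.ι j ▷ U := rfl

end Monoidal

end Splitting

lemma IsDirectSum.nonempty_splitting {J : Type*} [Fintype J] {X : C} {f : J → C}
    (h : IsDirectSum X f) : Nonempty (Splitting X f) := by
  obtain ⟨b, ⟨hb⟩, ⟨e⟩⟩ := h
  have total : ∑ j, (e.inv ≫ b.π j) ≫ b.ι j ≫ e.hom = e.inv ≫ (∑ j, b.π j ≫ b.ι j) ≫ e.hom := by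
    simp only [Preadditive.comp_sum, Preadditive.sum_comp, Category.assoc]
  exact ⟨{
    ι := fun j => b.ι j ≫ e.hom
    π := fun j => e.inv ≫ b.π j
    ι_π_self := fun j => by simp
    ι_π_ne := fun h => by simp [bicone_ι_π_ne b h]
    total := by rw [total, IsBilimit.total hb, Category.id_comp, e.inv_hom_id] }⟩

lemma exists_splitting_of_idempotent [IsIdempotentComplete C] {X : C} (e : X ⟶ X)
    (he : e ≫ e = e) : ∃ (Y : Bool → C) (s : Splitting X Y), s.π true ≫ s.ι true = e := by
  obtain ⟨Y₁, i₁, p₁, h₁, e₁⟩ := IsIdempotentComplete.idempotents_split X e he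
  obtain ⟨Y₂, i₂, p₂, h₂, e₂⟩ := IsIdempotentComplete.idempotents_split X (𝟙 X - e)
    (by simp [Preadditive.comp_sub, Preadditive.sub_comp, he])
  have h₁₂ : i₁ ≫ p₂ = 0 := by
    have : i₁ ≫ (p₁ ≫ i₁ + p₂ ≫ i₂) ≫ p₂ = i₁ ≫ p₂ := by rw [e₁, e₂]; simp
    simpa [reassoc_of% h₁, h₂] using this
  have h₂₁ : i₂ ≫ p₁ = 0 := by
    have : i₂ ≫ (p₁ ≫ i₁ + p₂ ≫ i₂) ≫ p₁ = i₂ ≫ p₁ := by rw [e₁, e₂]; simp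
    simpa [reassoc_of% h₂, h₁] using this
  exact ⟨Bool.rec Y₂ Y₁,
    { ι := Bool.rec i₂ i₁
      π := Bool.rec p₂ p₁
      ι_π_self := Bool.rec h₂ h₁
      ι_π_ne := by rintro (_ | _) (_ | _) h <;> first | exact (h rfl).elim | assumption
      total := by simp [e₁, e₂] }, e₁⟩

end Splitting

section Regular
variable {C : Type u} [Category.{v} C] [Preadditive C]

/-- Von Neumann regularity of a morphism. It is the Hom-level form of semisimplicity, and
passes from `C` to the center by averaging, while subobjects do not. -/
def IsVonNeumannRegular {X Y : C} (f : X ⟶ Y) : Prop := ∃ g : Y ⟶ X, f ≫ g ≫ f = f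

-- McCoy's lemma
lemma IsVonNeumannRegular.of_sub {X Y : C} {f : X ⟶ Y} (h : Y ⟶ X)
    (hf : IsVonNeumannRegular (f - f ≫ h ≫ f)) : IsVonNeumannRegular f := by
  obtain ⟨g, hg⟩ := hf
  refine ⟨h + (𝟙 Y - h ≫ f) ≫ g ≫ (𝟙 X - f ≫ h), ?_⟩
  calc f ≫ (h + (𝟙 Y - h ≫ f) ≫ g ≫ (𝟙 X - f ≫ h)) ≫ f
      = f ≫ h ≫ f + (f - f ≫ h ≫ f) ≫ g ≫ (f - f ≫ h ≫ f) := by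
        simp [Preadditive.comp_sub, Preadditive.sub_comp]
    _ = f := by rw [hg]; abel

end Regular

section Linear
variable {C : Type u} [Category.{v} C] [Preadditive C] {𝕜 : Type w} [Field 𝕜] [Linear 𝕜 C]

lemma IsSimpleObj.id_ne_zero {X : C} (h : IsSimpleObj 𝕜 X) : 𝟙 X ≠ 0 := by
  obtain ⟨e⟩ := h
  intro h0
  have h1 : e 1 = e 0 := by rw [← Category.comp_id (e 1), h0, comp_zero, map_zero]
  exact one_ne_zero (e.injective h1)

lemma IsSimpleObj.exists_smul {X : C} (h : IsSimpleObj 𝕜 X) (f : X ⟶ X) :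
    ∃ c : 𝕜, f = c • 𝟙 X := by
  have h0 := h.id_ne_zero
  obtain ⟨e⟩ := h
  have h1 : e.symm (𝟙 X) ≠ 0 := by simpa using h0
  exact ⟨e.symm f / e.symm (𝟙 X), e.symm.injective (by
    rw [map_smul, smul_eq_mul, div_mul_cancel₀ _ h1])⟩

lemma isSimpleObj_of_exists_smul {X : C} (h0 : 𝟙 X ≠ 0) (h : ∀ f : X ⟶ X, ∃ c : 𝕜, f = c • 𝟙 X) :
    IsSimpleObj 𝕜 X := by
  refine ⟨LinearEquiv.ofBijective (LinearMap.toSpanSingleton 𝕜 (X ⟶ X) (𝟙 X))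
    ⟨LinearMap.ker_eq_bot.1 (LinearMap.ker_toSpanSingleton 𝕜 h0), fun f => ?_⟩⟩
  obtain ⟨c, rfl⟩ := h f
  exact ⟨c, LinearMap.toSpanSingleton_apply _ _ _ _⟩

lemma IsSimpleObj.of_iso {X Y : C} (h : IsSimpleObj 𝕜 X) (e : X ≅ Y) : IsSimpleObj 𝕜 Y :=
  ⟨h.some.trans (Linear.homCongr 𝕜 e e)⟩

lemma IsSimpleObj.nonempty_iso_of_regular {X Y : C} (hX : IsSimpleObj 𝕜 X) (hY : IsSimpleObj 𝕜 Y)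
    {f : X ⟶ Y} (hf : IsVonNeumannRegular f) (hf0 : f ≠ 0) : Nonempty (X ≅ Y) := by
  obtain ⟨g, hg⟩ := hf
  obtain ⟨a, ha⟩ := hX.exists_smul (f ≫ g)
  obtain ⟨b, hb⟩ := hY.exists_smul (g ≫ f)
  have eq_one {c : 𝕜} (hc : c • f = f) : c = 1 :=
    smul_left_injective 𝕜 hf0 (hc.trans (one_smul 𝕜 f).symm)
  have ha1 : a = 1 := eq_one (by rw [← Category.id_comp f, ← Linear.smul_comp, ← ha]; simpa)
  have hb1 : b = 1 := eq_one (by rw [← Category.comp_id f, ← Linear.comp_smul, ← hb]; simpa)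
  exact ⟨f, g, by rw [ha, ha1, one_smul], by rw [hb, hb1, one_smul]⟩

lemma finrank_end_lt_of_retract {X Y : C} [Module.Finite 𝕜 (X ⟶ X)] (r : Retract Y X)
    (hr : r.r ≫ r.i ≠ 𝟙 X) : Module.finrank 𝕜 (Y ⟶ Y) < Module.finrank 𝕜 (X ⟶ X) := by
  let L : (Y ⟶ Y) →ₗ[𝕜] (X ⟶ X) := (Linear.leftComp 𝕜 X r.r).comp (Linear.rightComp 𝕜 Y r.i)
  have hL (g : Y ⟶ Y) : L g = r.r ≫ g ≫ r.i := rfl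
  have hinj : Function.Injective L := fun a b hab => by
    simpa [hL] using congrArg (fun g => r.i ≫ g ≫ r.r) hab
  rw [← LinearMap.finrank_range_of_inj hinj]
  refine Submodule.finrank_lt fun htop => hr ?_
  obtain ⟨g, hg⟩ : 𝟙 X ∈ LinearMap.range L := htop ▸ Submodule.mem_top
  calc r.r ≫ r.i = (r.r ≫ r.i) ≫ L g := by rw [hg, Category.comp_id]
    _ = 𝟙 X := by rw [← hg, hL]; simp

lemma finrank_range_leftComp_sub_lt {S X Y : C} [Module.Finite 𝕜 (X ⟶ X)] (f : X ⟶ Y)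
    {a : S ⟶ X} {b : Y ⟶ S} (hab : a ≫ f ≫ b = 𝟙 S) (hS : 𝟙 S ≠ 0) :
    Module.finrank 𝕜 (LinearMap.range (Linear.leftComp 𝕜 X (f - f ≫ b ≫ a ≫ f))) <
      Module.finrank 𝕜 (LinearMap.range (Linear.leftComp 𝕜 X f)) := by
  refine Submodule.finrank_lt_finrank_of_lt (lt_of_le_of_ne ?_ fun heq => hS ?_)
  · rintro _ ⟨g, rfl⟩
    exact ⟨g - b ≫ a ≫ f ≫ g, by simp [Preadditive.sub_comp, Preadditive.comp_sub]⟩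
  · obtain ⟨g, hg⟩ : f ≫ b ≫ a ∈ LinearMap.range (Linear.leftComp 𝕜 X (f - f ≫ b ≫ a ≫ f)) :=
      heq ▸ ⟨b ≫ a, rfl⟩
    have ha : a = 0 := calc
      a = a ≫ f ≫ b ≫ a := by rw [← Category.id_comp a, ← hab]; simp [reassoc_of% hab]
      _ = a ≫ (f - f ≫ b ≫ a ≫ f) ≫ g := by rw [← hg]; rfl
      _ = 0 := by simp [Preadditive.sub_comp, Preadditive.comp_sub, reassoc_of% hab]
    rw [← hab, ha, zero_comp]

namespace IsSplitSemisimple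

lemma exists_splitting (h : IsSplitSemisimple C 𝕜) (X : C) :
    ∃ (n : ℕ) (f : Fin n → C), (∀ j, IsSimpleObj 𝕜 (f j)) ∧ Nonempty (Splitting X f) := by
  obtain ⟨n, f, hf, hX⟩ := h.decomposes X
  exact ⟨n, f, hf, hX.nonempty_splitting⟩

lemma nonempty_iso (h : IsSplitSemisimple C 𝕜) {X Y : C} (hX : IsSimpleObj 𝕜 X)
    (hY : IsSimpleObj 𝕜 Y) {f : X ⟶ Y} (hf : f ≠ 0) : Nonempty (X ≅ Y) :=
  not_isEmpty_iff.1 fun he => hf (h.hom_eq_zero X Y hX hY he f)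

lemma finite_hom_of_isSimpleObj (h : IsSplitSemisimple C 𝕜) {X Y : C} (hX : IsSimpleObj 𝕜 X)
    (hY : IsSimpleObj 𝕜 Y) : Module.Finite 𝕜 (X ⟶ Y) := by
  rcases isEmpty_or_nonempty (X ≅ Y) with he | ⟨⟨e⟩⟩
  · have : Subsingleton (X ⟶ Y) := subsingleton_of_forall_eq 0 (h.hom_eq_zero X Y hX hY he)
    infer_instance
  · exact Module.Finite.equiv (hX.some.trans (Linear.homCongr 𝕜 (Iso.refl X) e))

lemma finite_hom (h : IsSplitSemisimple C 𝕜) (X Y : C) : Module.Finite 𝕜 (X ⟶ Y) := by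
  obtain ⟨n, f, hf, ⟨s⟩⟩ := h.exists_splitting X
  obtain ⟨m, g, hg, ⟨t⟩⟩ := h.exists_splitting Y
  have (j : Fin n) (k : Fin m) := h.finite_hom_of_isSimpleObj (hf j) (hg k)
  let components : (X ⟶ Y) →ₗ[𝕜] ∀ (j : Fin n) (k : Fin m), f j ⟶ g k :=
    LinearMap.pi fun j => LinearMap.pi fun k =>
      (Linear.leftComp 𝕜 (g k) (s.ι j)).comp (Linear.rightComp 𝕜 X (t.π k))
  refine Module.Finite.of_injective components fun a b hab =>
    s.hom_ext_right fun j => t.hom_ext_left fun k => ?_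
  simpa [components] using congr_fun (congr_fun hab j) k

lemma exists_simple_retract (h : IsSplitSemisimple C 𝕜) {X Y : C} {f : X ⟶ Y} (hf : f ≠ 0) :
    ∃ (S : C) (a : S ⟶ X) (b : Y ⟶ S), IsSimpleObj 𝕜 S ∧ a ≫ f ≫ b = 𝟙 S := by
  obtain ⟨n, S, hS, ⟨s⟩⟩ := h.exists_splitting X
  obtain ⟨m, T, hT, ⟨t⟩⟩ := h.exists_splitting Y
  obtain ⟨j, k, hjk⟩ : ∃ j k, s.ι j ≫ f ≫ t.π k ≠ 0 := by
    by_contra! H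
    exact hf (s.hom_ext_right fun j => t.hom_ext_left fun k => by simp [H])
  obtain ⟨e⟩ := h.nonempty_iso (hS j) (hT k) hjk
  obtain ⟨c, hc⟩ := (hS j).exists_smul (s.ι j ≫ f ≫ t.π k ≫ e.inv)
  have hc0 : c ≠ 0 := by
    rintro rfl
    exact hjk (by simpa [← cancel_mono e.inv] using hc)
  exact ⟨S j, s.ι j, c⁻¹ • (t.π k ≫ e.inv), hS j, by simp [hc, smul_smul, hc0]⟩

/-- Induction on the rank of a morphism `f`: subtracting `f ≫ b ≫ a ≫ f` removes from `f` a simple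
object on which it is invertible. -/
theorem hom_induction (h : IsSplitSemisimple C 𝕜) {X Y : C} {motive : (X ⟶ Y) → Prop}
    (zero : motive 0)
    (sub : ∀ (f : X ⟶ Y) (S : C) (a : S ⟶ X) (b : Y ⟶ S), a ≫ f ≫ b = 𝟙 S →
      motive (f - f ≫ b ≫ a ≫ f) → motive f) (f : X ⟶ Y) : motive f := by
  have := h.finite_hom X X
  induction hn : Module.finrank 𝕜 (LinearMap.range (Linear.leftComp 𝕜 X f))
    using Nat.strong_induction_on generalizing f with
  | _ n ih =>
  by_cases hf : f = 0
  · exact hf ▸ zero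
  · obtain ⟨S, a, b, hS, hab⟩ := h.exists_simple_retract hf
    exact sub f S a b hab
      (ih _ (hn ▸ finrank_range_leftComp_sub_lt f hab hS.id_ne_zero) _ rfl)

theorem isVonNeumannRegular (h : IsSplitSemisimple C 𝕜) {X Y : C} (f : X ⟶ Y) :
    IsVonNeumannRegular f := by
  induction f using h.hom_induction with
  | zero => exact ⟨0, by simp⟩
  | sub f S a b _ hf => exact IsVonNeumannRegular.of_sub (b ≫ a) (by simpa using hf)

open ZeroObject in
theorem isIdempotentComplete (h : IsSplitSemisimple C 𝕜) [HasFiniteBiproducts C] :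
    IsIdempotentComplete C := by
  have := hasBinaryBiproducts_of_finite_biproducts C
  refine ⟨fun X e he => ?_⟩
  induction e using h.hom_induction with
  | zero => exact ⟨0, 0, 0, by simp, by simp⟩
  | sub e S a b hab ih =>
    obtain ⟨Y, i, p, hip, hpi⟩ := ih (by
      simp [Preadditive.sub_comp, Preadditive.comp_sub, he, reassoc_of% he, reassoc_of% hab])
    have : IsSplitMono i := ⟨⟨p, hip⟩⟩
    have : IsSplitEpi p := ⟨⟨i, hip⟩⟩
    have hib : i ≫ e ≫ b = 0 := by
      rw [← cancel_epi p]
      simp [reassoc_of% hpi, Preadditive.sub_comp, reassoc_of% he, hab]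
    have hap : a ≫ e ≫ p = 0 := by
      rw [← cancel_mono i]
      simp [hpi, Preadditive.comp_sub, he, reassoc_of% he, reassoc_of% hab]
    refine ⟨Y ⊞ S, biprod.desc i (a ≫ e), biprod.lift p (e ≫ b), ?_, ?_⟩
    · ext <;> simp [hip, hib, hap, hab, reassoc_of% he]
    · simp [hpi]

end IsSplitSemisimple

end Linear

section Criterion
variable {D : Type u} [Category.{v} D] [Preadditive D] {𝕜 : Type w} [Field 𝕜] [IsAlgClosed 𝕜]
  [Linear 𝕜 D]

-- If `c` is an eigenvalue of `f` and `g` a quasi-inverse of `f - c`, then the idempotent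
-- `g (f - c)` kills an eigenvector, hence is not the identity.
lemma isSimpleObj_of_idempotents_trivial {X : D} [Module.Finite 𝕜 (X ⟶ X)] (h0 : 𝟙 X ≠ 0)
    (reg : ∀ f : X ⟶ X, IsVonNeumannRegular f)
    (idem : ∀ e : X ⟶ X, e ≫ e = e → e = 0 ∨ e = 𝟙 X) : IsSimpleObj 𝕜 X := by
  refine isSimpleObj_of_exists_smul h0 fun f => ?_
  have : Nontrivial (X ⟶ X) := ⟨⟨_, _, h0⟩⟩
  obtain ⟨c, hc⟩ := Module.End.exists_eigenvalue (Linear.leftComp 𝕜 X f)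
  obtain ⟨x, hx, hx0⟩ := hc.exists_hasEigenvector
  rw [Module.End.mem_eigenspace_iff] at hx
  have hfx : (f - c • 𝟙 X) ≫ x = 0 := by
    rw [Preadditive.sub_comp, Linear.smul_comp, Category.id_comp, sub_eq_zero]
    exact hx
  obtain ⟨g, hg⟩ := reg (f - c • 𝟙 X)
  refine ⟨c, sub_eq_zero.1 ?_⟩
  rcases idem (g ≫ (f - c • 𝟙 X)) (by rw [Category.assoc, hg]) with h | h
  · rw [← hg, h, comp_zero]
  · refine absurd ?_ hx0
    rw [← Category.id_comp x, ← h, Category.assoc, hfx, comp_zero]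

theorem exists_splitting_isSimpleObj [IsIdempotentComplete D]
    (fin : ∀ X : D, Module.Finite 𝕜 (X ⟶ X))
    (reg : ∀ {X : D} (f : X ⟶ X), IsVonNeumannRegular f) (X : D) :
    ∃ (J : Type) (_ : Fintype J) (f : J → D), (∀ j, IsSimpleObj 𝕜 (f j)) ∧
      Nonempty (Splitting X f) := by
  induction hn : Module.finrank 𝕜 (X ⟶ X) using Nat.strong_induction_on generalizing X with
  | _ n ih =>
  by_cases h0 : 𝟙 X = 0
  · exact ⟨PEmpty, inferInstance, fun j => j.elim, fun j => j.elim, ⟨.empty h0 _⟩⟩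
  by_cases idem : ∀ e : X ⟶ X, e ≫ e = e → e = 0 ∨ e = 𝟙 X
  · exact ⟨Unit, inferInstance, fun _ => X,
      fun _ => isSimpleObj_of_idempotents_trivial h0 reg idem, ⟨.single X⟩⟩
  push Not at idem
  obtain ⟨e, he, he0, he1⟩ := idem
  obtain ⟨Y, s, hs⟩ := exists_splitting_of_idempotent e he
  have hs1 (b : Bool) : s.π b ≫ s.ι b ≠ 𝟙 X := by
    have htotal := s.total
    rw [Fintype.sum_bool, hs] at htotal
    cases b
    · exact fun h => he0 (by simpa [h] using htotal)
    · exact hs ▸ he1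
  choose J _ f hf t using fun b =>
    ih _ (hn ▸ finrank_end_lt_of_retract (s.retract b) (hs1 b)) (Y b) rfl
  exact ⟨Σ b, J b, inferInstance, fun x => f x.1 x.2, fun x => hf x.1 x.2,
    ⟨s.sigma fun b => (t b).some⟩⟩

theorem isSplitSemisimple_of_regular [IsIdempotentComplete D]
    (fin : ∀ X : D, Module.Finite 𝕜 (X ⟶ X))
    (reg : ∀ {X Y : D} (f : X ⟶ Y), IsVonNeumannRegular f) : IsSplitSemisimple D 𝕜 where
  decomposes X := by
    obtain ⟨J, _, f, hf, ⟨s⟩⟩ := exists_splitting_isSimpleObj fin (fun f => reg f) X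
    exact ⟨Fintype.card J, fun j => f ((Fintype.equivFin J).symm j), fun j => hf _,
      (s.reindex (Fintype.equivFin J).symm).isDirectSum⟩
  hom_eq_zero X Y hX hY hXY f := by
    by_contra hf
    exact hXY.false (hX.nonempty_iso_of_regular hY (reg f) hf).some

end Criterion

section Graded
variable {C : Type u} [Category.{v} C] [MonoidalCategory C] [Preadditive C]
  {G : Type w'} [Group G] {grading : G → ObjectProperty C} [IsGGraded grading]

lemma exists_splitting_mem {α : G} {J : Type*} [Fintype J] (f : J → C)
    (hf : ∀ j, grading α (f j)) : ∃ X, grading α X ∧ Nonempty (Splitting X f) := by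
  obtain ⟨X, hX, hX'⟩ := IsGGraded.additive (grading := grading) α (Fintype.card J)
    (fun j => f ((Fintype.equivFin J).symm j)) (fun j => hf _)
  obtain ⟨s⟩ := hX'.nonempty_splitting
  exact ⟨X, hX, ⟨by simpa using s.reindex (Fintype.equivFin J)⟩⟩

lemma exists_iso_of_retract {α : G} {X Y : C} (hX : grading α X) (r : Retract Y X) :
    ∃ Z, grading α Z ∧ Nonempty (Y ≅ Z) := by
  obtain ⟨t, T, hT, hY⟩ := IsGGraded.splits (grading := grading) Y
  obtain ⟨s⟩ := hY.nonempty_splitting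
  have hz (β : t) (hβ : (β : G) ≠ α) : s.π β ≫ s.ι β = 0 := by
    rw [← cancel_mono r.i, Category.assoc,
      IsGGraded.hom_eq_zero (hT β β.2) hX hβ (s.ι β ≫ r.i), comp_zero, zero_comp]
  by_cases hα : α ∈ t
  · refine ⟨T α, hT α hα, ⟨⟨s.π ⟨α, hα⟩, s.ι ⟨α, hα⟩, ?_, s.ι_π_self ⟨α, hα⟩⟩⟩⟩
    rw [← s.total, Finset.sum_eq_single (⟨α, hα⟩ : t) _ (by simp)]
    exact fun β _ hβ => hz β fun h => hβ (Subtype.ext h)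
  · have hY0 : 𝟙 Y = 0 := by
      rw [← s.total]
      exact Finset.sum_eq_zero fun β _ => hz β fun h => hα (h ▸ β.2)
    obtain ⟨Z, hZ, ⟨s'⟩⟩ := exists_splitting_mem (grading := grading) (α := α)
      (fun j : PEmpty.{1} => (j.elim : C)) (fun j => j.elim)
    have hZ0 : 𝟙 Z = 0 := by rw [← s'.total, Fintype.sum_empty]
    exact ⟨Z, hZ, ⟨⟨0, 0, by rw [hY0, zero_comp], by rw [hZ0, zero_comp]⟩⟩⟩

end Graded

namespace RelCenter
variable {C : Type u} [Category.{v} C] [MonoidalCategory C]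
variable {P : ObjectProperty C} [P.IsMonoidal]

section Retract
variable (A : RelCenter P) {Y : C} (r : Retract Y A.pt)
  (hr : ∀ (U : C) (hU : P U), (r.r ≫ r.i) ▷ U ≫ A.σ U hU = A.σ U hU ≫ U ◁ (r.r ≫ r.i))

/-- The half braiding that `A` induces on a retract of its underlying object whose idempotent is a
morphism of the relative center. -/
def ofRetract : RelCenter P where
  pt := Y
  half :=
    { β := fun U hU =>
        { hom := r.i ▷ U ≫ A.σ U hU ≫ U ◁ r.r
          inv := U ◁ r.i ≫ (A.half.β U hU).inv ≫ r.r ▷ U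
          hom_inv_id := by
            calc
              _ = r.i ▷ U ≫ (A.σ U hU ≫ U ◁ (r.r ≫ r.i)) ≫ (A.half.β U hU).inv ≫ r.r ▷ U := by
                simp
              _ = ((r.i ≫ r.r) ≫ (r.i ≫ r.r)) ▷ U := by
                rw [← hr]
                simp only [comp_whiskerRight, Category.assoc, Iso.hom_inv_id_assoc]
              _ = _ := by simp only [r.retract, Category.comp_id, id_whiskerRight]
          inv_hom_id := by
            calc
              _ = U ◁ r.i ≫ (A.half.β U hU).inv ≫ ((r.r ≫ r.i) ▷ U ≫ A.σ U hU) ≫ U ◁ r.r := by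
                simp
              _ = U ◁ ((r.i ≫ r.r) ≫ (r.i ≫ r.r)) := by
                rw [hr]
                simp only [MonoidalCategory.whiskerLeft_comp, Category.assoc,
                  Iso.inv_hom_id_assoc]
              _ = _ := by simp only [r.retract, Category.comp_id, MonoidalCategory.whiskerLeft_id] }
      naturality := fun {U V} hU hV f => by
        calc
          _ = r.i ▷ U ≫ (A.pt ◁ f ≫ (A.half.β V hV).hom) ≫ V ◁ r.r := by
            simp [whisker_exchange_assoc]
          _ = _ := by rw [A.half.naturality hU hV]; simp [whisker_exchange]
      monoidal := fun U V hU hV => by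
        have hm : A.σ (U ⊗ V) (P.prop_tensor hU hV) = _ := A.half.monoidal U V hU hV
        symm
        calc
          _ = 𝟙 _ ⊗≫ (r.i ▷ U ≫ (A.σ U hU ≫ U ◁ (r.r ≫ r.i))) ▷ V ⊗≫
                U ◁ (A.σ V hV ≫ V ◁ r.r) ⊗≫ 𝟙 _ := by dsimp only; monoidal
          _ = 𝟙 _ ⊗≫ (r.i ≫ r.r ≫ r.i) ▷ U ▷ V ⊗≫ A.σ U hU ▷ V ⊗≫
                U ◁ (A.σ V hV ≫ V ◁ r.r) ⊗≫ 𝟙 _ := by rw [← hr]; monoidal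
          _ = _ := by
            dsimp only
            rw [r.retract_assoc, hm]
            monoidal }

/-- The retract lifted to the relative center. -/
def liftRetract : Retract (ofRetract A r hr) A where
  i :=
    { f := r.i
      comm := fun U hU => calc
        r.i ▷ U ≫ A.σ U hU = (r.i ≫ r.r ≫ r.i) ▷ U ≫ A.σ U hU := by rw [r.retract_assoc]
        _ = r.i ▷ U ≫ (r.r ≫ r.i) ▷ U ≫ A.σ U hU := by rw [← comp_whiskerRight_assoc]
        _ = (r.i ▷ U ≫ A.σ U hU ≫ U ◁ r.r) ≫ U ◁ r.i := by rw [hr]; simp }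
  r :=
    { f := r.r
      comm := fun U hU => calc
        r.r ▷ U ≫ r.i ▷ U ≫ A.σ U hU ≫ U ◁ r.r = ((r.r ≫ r.i) ▷ U ≫ A.σ U hU) ≫ U ◁ r.r := by simp
        _ = A.σ U hU ≫ U ◁ r.r := by rw [hr]; simp [← MonoidalCategory.whiskerLeft_comp] }
  retract := hom_ext r.retract

instance [IsIdempotentComplete C] : IsIdempotentComplete (RelCenter P) := ⟨fun A e he => by
  obtain ⟨Y, i, p, hip, hpi⟩ :=
    IsIdempotentComplete.idempotents_split A.pt (Hom.f e) (congrArg Hom.f he)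
  let s := liftRetract A ⟨i, p, hip⟩ fun U hU => hpi ▸ hom_comm e U hU
  exact ⟨_, s.i, s.r, s.retract, hom_ext hpi⟩⟩

end Retract

section Sum
variable [Preadditive C] [MonoidalPreadditive C]

@[simp] lemma sum_f {A B : RelCenter P} {J : Type*} (s : Finset J) (f : J → (A ⟶ B)) :
    Hom.f (∑ j ∈ s, f j : A ⟶ B) = ∑ j ∈ s, Hom.f (f j) :=
  map_sum ({ toFun := fun g => Hom.f g, map_zero' := rfl, map_add' := fun _ _ => rfl } :
    (A ⟶ B) →+ (A.pt ⟶ B.pt)) f s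

variable {J : Type*} [Fintype J] {X : C} {A : J → RelCenter P}
  (s : Splitting X fun j => (A j).pt)

/-- The direct sum of the half braidings of the summands. -/
def directSumσ (U : C) (hU : P U) : X ⊗ U ≅ U ⊗ X :=
  (s.whiskerRight U).mapIso (s.whiskerLeft U) fun j => (A j).half.β U hU

lemma directSumσ_hom_π (U : C) (hU : P U) (j : J) :
    (directSumσ s U hU).hom ≫ U ◁ s.π j = s.π j ▷ U ≫ (A j).σ U hU :=
  (s.whiskerRight U).mapIso_hom_π (s.whiskerLeft U) _ j

lemma ι_directSumσ_hom (U : C) (hU : P U) (j : J) :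
    s.ι j ▷ U ≫ (directSumσ s U hU).hom = (A j).σ U hU ≫ U ◁ s.ι j :=
  (s.whiskerRight U).ι_mapIso_hom (s.whiskerLeft U) _ j

/-- The direct sum in the relative center with a given underlying direct sum. -/
def directSum : RelCenter P where
  pt := X
  half :=
    { β := directSumσ s
      naturality := fun {U V} hU hV f => (s.whiskerLeft V).hom_ext_left fun j => by
        rw [Splitting.whiskerLeft_π]
        calc
          _ = s.π j ▷ U ≫ (A j).pt ◁ f ≫ (A j).σ V hV := by
            rw [Category.assoc, directSumσ_hom_π, whisker_exchange_assoc]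
          _ = (directSumσ s U hU).hom ≫ U ◁ s.π j ≫ f ▷ (A j).pt := by
            rw [(A j).half.naturality hU hV f, reassoc_of% directSumσ_hom_π s U hU j]
          _ = _ := by rw [whisker_exchange, Category.assoc]
      monoidal := fun U V hU hV => (s.whiskerLeft (U ⊗ V)).hom_ext_left fun j => by
        have hm : (A j).σ (U ⊗ V) (P.prop_tensor hU hV) = _ := (A j).half.monoidal U V hU hV
        rw [Splitting.whiskerLeft_π]
        symm
        calc
          _ = 𝟙 _ ⊗≫ (directSumσ s U hU).hom ▷ V ⊗≫
                U ◁ ((directSumσ s V hV).hom ≫ V ◁ s.π j) ⊗≫ 𝟙 _ := by monoidal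
          _ = 𝟙 _ ⊗≫ ((directSumσ s U hU).hom ≫ U ◁ s.π j) ▷ V ⊗≫
                U ◁ (A j).σ V hV ⊗≫ 𝟙 _ := by rw [directSumσ_hom_π]; monoidal
          _ = s.π j ▷ (U ⊗ V) ≫ (A j).σ (U ⊗ V) (P.prop_tensor hU hV) := by
            rw [directSumσ_hom_π, hm]
            monoidal
          _ = _ := (directSumσ_hom_π s _ _ j).symm }

/-- The splitting of a direct sum in the relative center. -/
def directSumSplitting : Splitting (directSum s) A where
  ι j := { f := s.ι j, comm := fun U hU => ι_directSumσ_hom s U hU j }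
  π j := { f := s.π j, comm := fun U hU => (directSumσ_hom_π s U hU j).symm }
  ι_π_self j := hom_ext (s.ι_π_self j)
  ι_π_ne h := hom_ext (s.ι_π_ne h)
  total := hom_ext (by rw [sum_f]; exact s.total)

instance [HasFiniteBiproducts C] : HasFiniteBiproducts (RelCenter P) :=
  ⟨fun _ => ⟨fun F =>
    (directSumSplitting (A := F) (Splitting.biproduct fun j => (F j).pt)).hasBiproduct⟩⟩

end Sum

end RelCenter

section Graded
variable {C : Type u} [Category.{v} C] [MonoidalCategory C] [Preadditive C]
  {G : Type w'} [Group G] {grading : G → ObjectProperty C} [IsGGraded grading]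

lemma IsGGraded.tensor_one {α : G} {X U : C} (hX : grading α X) (hU : grading 1 U) :
    grading α (X ⊗ U) := mul_one α ▸ IsGGraded.tensor hX hU

lemma IsGGraded.one_tensor {α : G} {X U : C} (hX : grading α X) (hU : grading 1 U) :
    grading α (U ⊗ X) := one_mul α ▸ IsGGraded.tensor hU hX

variable [MonoidalPreadditive C]

-- The half braiding preserves degrees, so it has no matrix entries between distinct summands.
lemma GCenter.idempotent_comm (A : GCenter grading) {t : Finset G} {Y : G → C}
    (hY : ∀ α ∈ t, grading α (Y α)) (s : Splitting A.pt fun α : t => Y α) (β : t) (U : C)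
    (hU : grading 1 U) : (s.π β ≫ s.ι β) ▷ U ≫ A.σ U hU = A.σ U hU ≫ U ◁ (s.π β ≫ s.ι β) := by
  have entry {γ δ : t} (h : γ ≠ δ) : s.ι γ ▷ U ≫ A.σ U hU ≫ U ◁ s.π δ = 0 :=
    IsGGraded.hom_eq_zero (IsGGraded.tensor_one (hY γ γ.2) hU) (IsGGraded.one_tensor (hY δ δ.2) hU)
      (fun h' => h (Subtype.ext h')) _
  have row : s.ι β ▷ U ≫ A.σ U hU = (s.ι β ▷ U ≫ A.σ U hU ≫ U ◁ s.π β) ≫ U ◁ s.ι β :=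
    (s.whiskerLeft U).hom_ext_left fun δ => by
      obtain rfl | h := eq_or_ne β δ
      · simp [← MonoidalCategory.whiskerLeft_comp]
      · simp [← MonoidalCategory.whiskerLeft_comp, s.ι_π_ne h, entry h]
  have column : A.σ U hU ≫ U ◁ s.π β = s.π β ▷ U ≫ s.ι β ▷ U ≫ A.σ U hU ≫ U ◁ s.π β :=
    (s.whiskerRight U).hom_ext_right fun γ => by
      obtain rfl | h := eq_or_ne γ β
      · rw [Splitting.whiskerRight_ι, ← comp_whiskerRight_assoc, s.ι_π_self, id_whiskerRight,
          Category.id_comp]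
      · rw [Splitting.whiskerRight_ι, entry h, ← comp_whiskerRight_assoc, s.ι_π_ne h,
          MonoidalPreadditive.zero_whiskerRight, zero_comp]
  rw [comp_whiskerRight_assoc, row, MonoidalCategory.whiskerLeft_comp, reassoc_of% column]
  simp only [Category.assoc]

instance isGGraded_center : IsGGraded (centerGrading grading) where
  hasFiniteBiproducts := by
    have := IsGGraded.hasFiniteBiproducts (grading := grading)
    infer_instance
  additive α n f hf := by
    obtain ⟨X, hX, ⟨s⟩⟩ := exists_splitting_mem (fun j => (f j).pt) hf
    exact ⟨RelCenter.directSum s, hX, (RelCenter.directSumSplitting s).isDirectSum⟩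
  splits A := by
    classical
    obtain ⟨t, Y, hY, hA⟩ := IsGGraded.splits (grading := grading) A.pt
    obtain ⟨s⟩ := hA.nonempty_splitting
    let r (β : t) := RelCenter.liftRetract A (s.retract β) (GCenter.idempotent_comm A hY s β)
    let B (β : t) : GCenter grading :=
      RelCenter.ofRetract A (s.retract β) (GCenter.idempotent_comm A hY s β)
    let S : Splitting A B :=
      { ι := fun β => (r β).i
        π := fun β => (r β).r
        ι_π_self := fun β => (r β).retract
        ι_π_ne := fun h => RelCenter.hom_ext (s.ι_π_ne h)
        total := RelCenter.hom_ext (by rw [RelCenter.sum_f]; exact s.total) }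
    refine ⟨t, fun α => if h : α ∈ t then B ⟨α, h⟩ else A, fun α hα => ?_, ?_⟩
    · simp only [dif_pos hα]
      exact hY α hα
    · have hB : (fun α : t => if h : (α : G) ∈ t then B ⟨α, h⟩ else A) = B :=
        funext fun α => dif_pos α.2
      rw [hB]
      exact S.isDirectSum
  tensor hA hB := IsGGraded.tensor (grading := grading) hA hB
  hom_eq_zero hA hB h f := RelCenter.hom_ext (IsGGraded.hom_eq_zero (grading := grading) hA hB h _)
  unit := IsGGraded.unit (grading := grading)

end Graded

instance isPivotalGraded_center {C : Type u} [Category.{v} C] [Preadditive C] [MonoidalCategory C]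
    [MonoidalPreadditive C] [PivotalCategory C] {G : Type w'} [Group G]
    {grading : G → ObjectProperty C} [IsPivotalGraded grading] :
    IsPivotalGraded (centerGrading grading) where
  dual_mem h := IsPivotalGraded.dual_mem (grading := grading) h

section Rotation
variable {C : Type u} [Category.{v} C] [MonoidalCategory C] [DualityData C]

/-- The rotation `Y^* ⊗ U ⟶ X^*` of a morphism `U ⊗ X ⟶ Y`. -/
def rotOut {U X Y : C} (p : U ⊗ X ⟶ Y) : dual Y ⊗ U ⟶ dual X :=
  𝟙 _ ⊗≫ (dual Y ⊗ U) ◁ coev X ⊗≫ dual Y ◁ p ▷ dual X ⊗≫ ev Y ▷ dual X ⊗≫ 𝟙 _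

/-- The rotation `X^* ⟶ Y^* ⊗ U` of a morphism `Y ⟶ U ⊗ X`. -/
def rotIn {U X Y : C} (i : Y ⟶ U ⊗ X) : dual X ⟶ dual Y ⊗ U :=
  𝟙 _ ⊗≫ coevR Y ▷ dual X ⊗≫ dual Y ◁ i ▷ dual X ⊗≫ (dual Y ⊗ U) ◁ evR X ⊗≫ 𝟙 _

variable {U X Y : C}

lemma coev_rotOut (p : U ⊗ X ⟶ Y) :
    coev Y ▷ U ⊗≫ Y ◁ rotOut p = 𝟙 _ ⊗≫ U ◁ coev X ⊗≫ p ▷ dual X ⊗≫ 𝟙 _ := by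
  unfold rotOut
  calc
    _ = 𝟙 _ ⊗≫ (coev Y ▷ (U ⊗ 𝟙_ C) ≫ (Y ⊗ dual Y) ◁ (U ◁ coev X ⊗≫ p ▷ dual X)) ⊗≫
          Y ◁ ev Y ▷ dual X ⊗≫ 𝟙 _ := by monoidal
    _ = 𝟙 _ ⊗≫ U ◁ coev X ⊗≫ p ▷ dual X ⊗≫ (coev Y ▷ Y ⊗≫ Y ◁ ev Y) ▷ dual X ⊗≫ 𝟙 _ := by
        rw [← whisker_exchange]; monoidal
    _ = _ := by rw [tri1]; monoidal

lemma rotIn_evR (i : Y ⟶ U ⊗ X) :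
    Y ◁ rotIn i ⊗≫ evR Y ▷ U = 𝟙 _ ⊗≫ i ▷ dual X ⊗≫ U ◁ evR X ⊗≫ 𝟙 _ := by
  unfold rotIn
  calc
    _ = 𝟙 _ ⊗≫ Y ◁ coevR Y ▷ dual X ⊗≫ ((Y ⊗ dual Y) ◁ (i ▷ dual X ⊗≫ U ◁ evR X) ≫
          evR Y ▷ (U ⊗ 𝟙_ C)) ⊗≫ 𝟙 _ := by monoidal
    _ = 𝟙 _ ⊗≫ (Y ◁ coevR Y ⊗≫ evR Y ▷ Y) ▷ dual X ⊗≫ i ▷ dual X ⊗≫ U ◁ evR X ⊗≫ 𝟙 _ := by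
        rw [whisker_exchange]; monoidal
    _ = _ := by rw [tri4]; monoidal

lemma coevR_rotIn (i : Y ⟶ U ⊗ X) :
    coevR X ≫ rotIn i ▷ X = coevR Y ≫ dual Y ◁ i ≫ (α_ _ _ _).inv := by
  unfold rotIn
  calc
    _ = 𝟙 _ ⊗≫ (𝟙_ C ◁ coevR X ≫ (coevR Y ⊗≫ dual Y ◁ i) ▷ (dual X ⊗ X)) ⊗≫
          (dual Y ⊗ U) ◁ evR X ▷ X ⊗≫ 𝟙 _ := by monoidal
    _ = 𝟙 _ ⊗≫ coevR Y ⊗≫ dual Y ◁ i ⊗≫ (dual Y ⊗ U) ◁ (X ◁ coevR X ⊗≫ evR X ▷ X) ⊗≫ 𝟙 _ := by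
        rw [whisker_exchange]; monoidal
    _ = _ := by rw [tri4]; monoidal

lemma rotOut_ev (p : U ⊗ X ⟶ Y) :
    rotOut p ▷ X ≫ ev X = (α_ _ _ _).hom ≫ dual Y ◁ p ≫ ev Y := by
  unfold rotOut
  calc
    _ = 𝟙 _ ⊗≫ (dual Y ⊗ U) ◁ coev X ▷ X ⊗≫ ((dual Y ◁ p ⊗≫ ev Y) ▷ (dual X ⊗ X) ≫
          𝟙_ C ◁ ev X) ⊗≫ 𝟙 _ := by monoidal
    _ = 𝟙 _ ⊗≫ (dual Y ⊗ U) ◁ (coev X ▷ X ⊗≫ X ◁ ev X) ⊗≫ dual Y ◁ p ⊗≫ ev Y ⊗≫ 𝟙 _ := by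
        rw [← whisker_exchange]; monoidal
    _ = _ := by rw [tri1]; monoidal

lemma rotIn_surjective : Function.Surjective (rotIn : (Y ⟶ U ⊗ X) → (dual X ⟶ dual Y ⊗ U)) := by
  let _ := DualityData.right X
  let _ := DualityData.right Y
  have h : rotIn = (tensorRightHomEquiv Y (dual X) X U).symm.trans
      (tensorLeftHomEquiv (dual X) (dual Y) Y U) := funext fun i => by
    change _ = (λ_ _).inv ≫ coevR Y ▷ _ ≫ (α_ _ _ _).hom ≫
      _ ◁ (i ▷ _ ≫ (α_ _ _ _).hom ≫ _ ◁ evR X ≫ (ρ_ _).hom)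
    unfold rotIn
    monoidal
  exact h ▸ Equiv.surjective _

lemma rotIn_leftUnitor (X : C) : rotIn (λ_ X).inv = (ρ_ (dual X)).inv := by
  unfold rotIn
  calc
    _ = 𝟙 _ ⊗≫ (coevR X ▷ dual X ⊗≫ dual X ◁ evR X) ⊗≫ 𝟙 _ := by monoidal
    _ = _ := by rw [tri3]; monoidal

lemma rotOut_comp_left {V : C} (f : U ⟶ V) (p : V ⊗ X ⟶ Y) :
    rotOut (f ▷ X ≫ p) = dual Y ◁ f ≫ rotOut p := by
  unfold rotOut
  symm
  calc
    _ = 𝟙 _ ⊗≫ dual Y ◁ (f ▷ 𝟙_ C ≫ V ◁ coev X) ⊗≫ dual Y ◁ p ▷ dual X ⊗≫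
          ev Y ▷ dual X ⊗≫ 𝟙 _ := by monoidal
    _ = _ := by rw [← whisker_exchange]; monoidal

lemma rotOut_comp_rotOut {V Z : C} (p : U ⊗ X ⟶ Y) (p' : V ⊗ Z ⟶ X) :
    rotOut p ▷ V ≫ rotOut p' =
      (α_ _ _ _).hom ≫ rotOut ((α_ U V Z).hom ≫ U ◁ p' ≫ p) := by
  calc
    _ = 𝟙 _ ⊗≫ (rotOut p ▷ (V ⊗ 𝟙_ C) ≫ dual X ◁ (V ◁ coev Z ⊗≫ p' ▷ dual Z)) ⊗≫
          ev X ▷ dual Z ⊗≫ 𝟙 _ := by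
        conv_lhs => enter [2]; unfold rotOut
        monoidal
    _ = 𝟙 _ ⊗≫ (dual Y ⊗ U) ◁ (V ◁ coev Z ⊗≫ p' ▷ dual Z) ⊗≫ (rotOut p ▷ X ≫
          ev X) ▷ dual Z ⊗≫ 𝟙 _ := by
        rw [← whisker_exchange]; monoidal
    _ = _ := by
        rw [rotOut_ev]
        unfold rotOut
        monoidal

lemma rotOut_leftUnitor (X : C) : rotOut (λ_ X).hom = (ρ_ (dual X)).hom := by
  unfold rotOut
  calc
    _ = 𝟙 _ ⊗≫ (dual X ◁ coev X ⊗≫ ev X ▷ dual X) ⊗≫ 𝟙 _ := by monoidal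
    _ = _ := by rw [tri2]; monoidal

variable [Preadditive C] [MonoidalPreadditive C] {𝕜 : Type w} [Field 𝕜] [Linear 𝕜 C]
  [MonoidalLinear 𝕜 C]

variable (𝕜) in
/-- `rotIn` as a linear map. -/
def rotInₗ : (Y ⟶ U ⊗ X) →ₗ[𝕜] (dual X ⟶ dual Y ⊗ U) where
  toFun := rotIn
  map_add' f g := by simp [rotIn, monoidalComp]
  map_smul' c f := by simp [rotIn, monoidalComp]

@[simp] lemma rotInₗ_apply (i : Y ⟶ U ⊗ X) : rotInₗ 𝕜 i = rotIn i := rfl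

end Rotation

section Resolution
variable {C : Type u} [Category.{v} C] [Preadditive C] {I : Type w'} [Fintype I]

/-- A factorization of the identity of `W` through the objects `S j`, each taken with a finite
multiplicity. -/
structure Resolution (S : I → C) (W : C) where
  mult : I → Type
  [fintype (j : I) : Fintype (mult j)]
  ι (x : Σ j, mult j) : S x.1 ⟶ W
  π (x : Σ j, mult j) : W ⟶ S x.1
  total : ∑ x, π x ≫ ι x = 𝟙 W

attribute [instance] Resolution.fintype

/-- A finite family of pairwise non-isomorphic simple objects through which the identities of all
objects of `P` factor. -/
structure SimpleSystem (𝕜 : Type w) [Field 𝕜] [Linear 𝕜 C] (P : ObjectProperty C)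
    (I : Type w') [Fintype I] where
  S : I → C
  mem (i : I) : P (S i)
  simple (i : I) : IsSimpleObj 𝕜 (S i)
  hom_eq_zero {i j : I} (h : i ≠ j) (f : S i ⟶ S j) : f = 0
  res (W : C) (hW : P W) : Resolution S W

namespace SimpleSystem
variable {𝕜 : Type w} [Field 𝕜] [Linear 𝕜 C] {P : ObjectProperty C} (D : SimpleSystem 𝕜 P I)

lemma sum_comp_π_ι {W : C} (R : Resolution D.S W) {j : I} (h : D.S j ⟶ W) :
    ∑ k, h ≫ R.π ⟨j, k⟩ ≫ R.ι ⟨j, k⟩ = h := by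
  conv_rhs => rw [← Category.comp_id h, ← R.total, Preadditive.comp_sum, Fintype.sum_sigma]
  rw [Fintype.sum_eq_single j]
  intro i hi
  refine Finset.sum_eq_zero fun k _ => ?_
  rw [← Category.assoc, D.hom_eq_zero hi.symm (h ≫ R.π ⟨i, k⟩), zero_comp]

section Dinatural
variable {W W' : C} {M : Type*} [AddCommGroup M] [Module 𝕜 M]

lemma bilin_comp_left (b : ∀ j, (D.S j ⟶ W') →ₗ[𝕜] (W ⟶ D.S j) →ₗ[𝕜] M) {i j : I}
    (φ : D.S i ⟶ D.S j) (x : D.S j ⟶ W') (y : W ⟶ D.S i) :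
    b i (φ ≫ x) y = b j x (y ≫ φ) := by
  obtain rfl | h := eq_or_ne i j
  · obtain ⟨c, rfl⟩ := (D.simple i).exists_smul φ
    simp
  · simp [D.hom_eq_zero h φ]

-- The canonical element of `⨁ j, Hom(S j, W) ⊗ Hom(W, S j)` is dinatural in `W`.
lemma dinatural (R : Resolution D.S W) (R' : Resolution D.S W') (u : W ⟶ W')
    (b : ∀ j, (D.S j ⟶ W') →ₗ[𝕜] (W ⟶ D.S j) →ₗ[𝕜] M) :
    ∑ x, b x.1 (R.ι x ≫ u) (R.π x) = ∑ x, b x.1 (R'.ι x) (u ≫ R'.π x) := by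
  calc
    _ = ∑ x, b x.1 (R.ι x ≫ u ≫ ∑ y, R'.π y ≫ R'.ι y) (R.π x) := by
      simp only [R'.total, Category.comp_id]
    _ = ∑ x, ∑ y, b x.1 ((R.ι x ≫ u ≫ R'.π y) ≫ R'.ι y) (R.π x) := by
      simp only [Preadditive.comp_sum, map_sum, LinearMap.sum_apply, Category.assoc]
    _ = ∑ y, ∑ x, b y.1 (R'.ι y) (R.π x ≫ R.ι x ≫ u ≫ R'.π y) := by
      rw [Finset.sum_comm]
      simp only [D.bilin_comp_left b]
    _ = ∑ y, b y.1 (R'.ι y) ((∑ x, R.π x ≫ R.ι x) ≫ u ≫ R'.π y) := by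
      simp only [Preadditive.sum_comp, map_sum, Category.assoc]
    _ = _ := by simp only [R.total, Category.id_comp]

lemma sum_bilin_eq_of_iso (R : Resolution D.S W) {i : I} (e : W ≅ D.S i)
    (b : ∀ j, (D.S j ⟶ W) →ₗ[𝕜] (W ⟶ D.S j) →ₗ[𝕜] M) :
    ∑ x, b x.1 (R.ι x) (R.π x) = b i e.inv e.hom := by
  calc
    _ = ∑ x, b x.1 ((R.ι x ≫ e.hom) ≫ e.inv) (R.π x) := by simp
    _ = ∑ x, b i e.inv ((R.π x ≫ R.ι x) ≫ e.hom) := by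
      simp only [D.bilin_comp_left b, ← Category.assoc]
    _ = b i e.inv e.hom := by rw [← map_sum, ← Preadditive.sum_comp, R.total, Category.id_comp]

end Dinatural

end SimpleSystem

end Resolution

section Casimir
variable {C : Type u} [Category.{v} C] [MonoidalCategory C] [Preadditive C]
  [MonoidalPreadditive C] {𝕜 : Type w} [Field 𝕜] [Linear 𝕜 C]
  {P : ObjectProperty C} {I : Type w'} [Fintype I]

namespace SimpleSystem
variable (D : SimpleSystem 𝕜 P I)

section Duality
variable [DualityData C]

lemma dual_hom_ext {W Z : C} (hW : P (dual W)) {f g : W ⟶ Z}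
    (H : ∀ (r : I) (h : dual (D.S r) ⟶ W), h ≫ f = h ≫ g) : f = g := by
  let R := D.res _ hW
  let pW : ExactPairing (dual W) W := DualityData.right W
  let pS (r : I) : ExactPairing (D.S r) (dual (D.S r)) := DualityData.left (D.S r)
  have mate_total : mateL pW.coevaluation' pW.evaluation' (𝟙 (dual W)) =
      ∑ x, mateL pW.coevaluation' pW.evaluation' (R.π x ≫ R.ι x) := by
    rw [← R.total]
    simp [mateL, sum_whiskerRight, whiskerLeft_sum, Preadditive.sum_comp, Preadditive.comp_sum]
  have id_eq : 𝟙 W = ∑ x, mateL (pS x.1).coevaluation' pW.evaluation' (R.ι x) ≫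
      mateL pW.coevaluation' (pS x.1).evaluation' (R.π x) := by
    rw [← mateL_id pW, mate_total]
    exact Finset.sum_congr rfl fun x _ => (mateL_comp pW (pS x.1) pW _ _).symm
  rw [← Category.id_comp f, ← Category.id_comp g, id_eq]
  simp only [Preadditive.sum_comp, Category.assoc, H]

variable [MonoidalLinear 𝕜 C]

lemma dual_hom_eq_zero {i j : I} (h : i ≠ j) (f : dual (D.S i) ⟶ dual (D.S j)) : f = 0 := by
  obtain ⟨g, hg⟩ := rotIn_surjective (f ≫ (ρ_ _).inv)
  have hg0 : g = 0 := by
    rw [← cancel_mono (λ_ _).hom, zero_comp]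
    exact D.hom_eq_zero h.symm _
  rw [← cancel_mono (ρ_ _).inv, ← hg, hg0, zero_comp]
  exact map_zero (rotInₗ 𝕜)

lemma exists_smul_dual (i : I) (f : dual (D.S i) ⟶ dual (D.S i)) :
    ∃ c : 𝕜, f = c • 𝟙 (dual (D.S i)) := by
  obtain ⟨g, hg⟩ := rotIn_surjective (f ≫ (ρ_ _).inv)
  obtain ⟨c, hc⟩ := (D.simple i).exists_smul (g ≫ (λ_ _).hom)
  have hgc : g = c • (λ_ _).inv := by
    rw [← cancel_mono (λ_ _).hom, hc]
    simp
  refine ⟨c, ?_⟩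
  rw [← cancel_mono (ρ_ _).inv, ← hg, hgc, ← rotInₗ_apply (𝕜 := 𝕜), map_smul]
  simp [rotIn_leftUnitor]

end Duality

section Pivotal
variable [MonoidalLinear 𝕜 C] [PivotalCategory C] {d : I → 𝕜}
  (hd : ∀ i, dimL (D.S i) = d i • 𝟙 (𝟙_ C)) (h1 : 𝟙 (𝟙_ C) ≠ 0)
include hd h1

lemma smul_rotIn_rotOut_rotIn {U : C} {j r : I} (h : D.S j ⟶ U ⊗ D.S r)
    (p : U ⊗ D.S r ⟶ D.S j) (i : D.S j ⟶ U ⊗ D.S r) :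
    d r • (rotIn h ≫ rotOut p ≫ rotIn i) = d j • rotIn (h ≫ p ≫ i) := by
  obtain ⟨a, ha⟩ := (D.simple j).exists_smul (h ≫ p)
  obtain ⟨c, hc⟩ := D.exists_smul_dual r (rotIn h ≫ rotOut p)
  have trace_eq : coevR (D.S r) ≫ (rotIn h ≫ rotOut p) ▷ D.S r ≫ ev (D.S r) =
      coevR (D.S j) ≫ dual (D.S j) ◁ (h ≫ p) ≫ ev (D.S j) := by
    rw [comp_whiskerRight, Category.assoc, rotOut_ev, reassoc_of% coevR_rotIn]
    simp
  have dim_eq (i : I) : coevR (D.S i) ≫ ev (D.S i) = d i • 𝟙 (𝟙_ C) := by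
    rw [← hd]
    simp [dimL, trL]
  have scalar_eq : d r * c = d j * a := by
    rw [ha, hc] at trace_eq
    refine smul_left_injective 𝕜 h1 ?_
    simpa [dim_eq, smul_smul, mul_comm] using trace_eq
  rw [← Category.assoc, hc, ← Category.assoc h, ha, Linear.smul_comp, Linear.smul_comp,
    Category.id_comp, Category.id_comp, smul_smul, scalar_eq, ← rotInₗ_apply (𝕜 := 𝕜) (a • i),
    map_smul, smul_smul, rotInₗ_apply]

variable [P.IsMonoidal] [DualStable P]

-- Weighted with the left dimensions, the rotations of resolutions of the objects `U ⊗ S i` resolve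
-- the object `(S j)^* ⊗ U`.
theorem sum_rotOut_rotIn {U : C} (hU : P U) (R : ∀ i, Resolution D.S (U ⊗ D.S i)) (j : I) :
    ∑ i, ∑ k, d i • (rotOut ((R i).π ⟨j, k⟩) ≫ rotIn ((R i).ι ⟨j, k⟩)) =
      d j • 𝟙 (dual (D.S j) ⊗ U) := by
  refine D.dual_hom_ext (DualStable.prop_dual (P.prop_tensor (DualStable.prop_dual (D.mem j)) hU))
    fun r g => ?_
  obtain ⟨h, rfl⟩ := rotIn_surjective g
  simp only [Preadditive.comp_sum, Linear.comp_smul, Category.comp_id]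
  rw [Fintype.sum_eq_single r fun i hi => Finset.sum_eq_zero fun k _ => ?_]
  · simp only [D.smul_rotIn_rotOut_rotIn hd h1]
    conv_rhs => rw [← D.sum_comp_π_ι (R r) h, ← rotInₗ_apply (𝕜 := 𝕜), map_sum, Finset.smul_sum]
    rfl
  · rw [← Category.assoc, D.dual_hom_eq_zero hi.symm (rotIn h ≫ rotOut _), zero_comp, smul_zero]

end Pivotal

end SimpleSystem
end Casimir

section Averaging
variable {C : Type u} [Category.{v} C] [MonoidalCategory C] {P : ObjectProperty C} [P.IsMonoidal]

namespace RelCenter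

/-- The conjugate of a morphism of `C` by half braidings. -/
def conj (A B : RelCenter P) (f : A.pt ⟶ B.pt) (X : C) (hX : P X) : A.pt ⊗ X ⟶ B.pt ⊗ X :=
  A.σ X hX ≫ X ◁ f ≫ (B.half.β X hX).inv

variable {A B : RelCenter P} (f : A.pt ⟶ B.pt)

lemma conj_naturality {X Y : C} (hX : P X) (hY : P Y) (g : X ⟶ Y) :
    A.pt ◁ g ≫ conj A B f Y hY = conj A B f X hX ≫ B.pt ◁ g := by
  unfold conj σ
  rw [← Category.assoc, A.half.naturality hX hY, Category.assoc, Category.assoc, Category.assoc,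
    ← B.half.inv_nat hX hY, whisker_exchange_assoc]

lemma conj_tensor {U X : C} (hU : P U) (hX : P X) :
    conj A B f (U ⊗ X) (P.prop_tensor hU hX) = (α_ _ _ _).inv ≫ A.σ U hU ▷ X ≫ (α_ _ _ _).hom ≫
      U ◁ conj A B f X hX ≫ (α_ _ _ _).inv ≫ (B.half.β U hU).inv ▷ X ≫ (α_ _ _ _).hom := by
  have hm : A.σ (U ⊗ X) (P.prop_tensor hU hX) = _ := A.half.monoidal U X hU hX
  unfold conj
  rw [hm, B.half.inv_mul hU hX]
  simp [σ]

lemma hom_conj {A' : RelCenter P} (g : A' ⟶ A) (X : C) (hX : P X) :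
    conj A' B (Hom.f g ≫ f) X hX = Hom.f g ▷ X ≫ conj A B f X hX := by
  unfold conj
  rw [MonoidalCategory.whiskerLeft_comp, ← Category.assoc, ← Category.assoc, ← hom_comm]
  simp

lemma conj_hom_comp {B' : RelCenter P} (g : B ⟶ B') (X : C) (hX : P X) :
    conj A B' (f ≫ Hom.f g) X hX = conj A B f X hX ≫ Hom.f g ▷ X := by
  have : (B.half.β X hX).inv ≫ Hom.f g ▷ X = X ◁ Hom.f g ≫ (B'.half.β X hX).inv := by
    rw [Iso.inv_comp_eq, ← Category.assoc, ← hom_comm]; simp [σ]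
  unfold conj
  simp [this]

variable [PivotalCategory C]

/-- The partial trace of the conjugate of a morphism. -/
def avg (A B : RelCenter P) (f : A.pt ⟶ B.pt) (X : C) (hX : P X) : A.pt ⟶ B.pt :=
  𝟙 _ ⊗≫ A.pt ◁ coev X ⊗≫ conj A B f X hX ▷ dual X ⊗≫ B.pt ◁ evR X ⊗≫ 𝟙 _

lemma hom_avg {A' : RelCenter P} (g : A' ⟶ A) (X : C) (hX : P X) :
    avg A' B (Hom.f g ≫ f) X hX = Hom.f g ≫ avg A B f X hX := by
  unfold avg
  rw [hom_conj]
  symm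
  calc
    _ = 𝟙 _ ⊗≫ (Hom.f g ▷ 𝟙_ C ≫ A.pt ◁ coev X) ⊗≫ conj A B f X hX ▷ dual X ⊗≫
          B.pt ◁ evR X ⊗≫ 𝟙 _ := by monoidal
    _ = _ := by rw [← whisker_exchange]; monoidal

lemma avg_hom_comp {B' : RelCenter P} (g : B ⟶ B') (X : C) (hX : P X) :
    avg A B' (f ≫ Hom.f g) X hX = avg A B f X hX ≫ Hom.f g := by
  unfold avg
  rw [conj_hom_comp]
  calc
    _ = 𝟙 _ ⊗≫ A.pt ◁ coev X ⊗≫ conj A B f X hX ▷ dual X ⊗≫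
          (Hom.f g ▷ (X ⊗ dual X) ≫ B'.pt ◁ evR X) ⊗≫ 𝟙 _ := by monoidal
    _ = _ := by rw [← whisker_exchange]; monoidal

lemma avg_id (X : C) (hX : P X) :
    avg A A (𝟙 A.pt) X hX = (ρ_ _).inv ≫ A.pt ◁ dimR X ≫ (ρ_ _).hom := by
  have : conj A A (𝟙 A.pt) X hX = 𝟙 _ := by simp [conj, σ]
  unfold avg
  rw [this]
  simp only [dimR, trR]
  monoidal

-- A closed half-braided loop slides across `U`.
lemma conj_avg {U X : C} (hU : P U) (hX : P X) :
    conj A B (avg A B f X hX) U hU =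
      𝟙 _ ⊗≫ A.pt ◁ U ◁ coev X ⊗≫ conj A B f (U ⊗ X) (P.prop_tensor hU hX) ▷ dual X ⊗≫
        B.pt ◁ U ◁ evR X ⊗≫ 𝟙 _ := by
  rw [conj_tensor f hU hX]
  symm
  calc
    _ = 𝟙 _ ⊗≫ ((A.pt ⊗ U) ◁ coev X ≫ A.σ U hU ▷ (X ⊗ dual X)) ⊗≫
          U ◁ conj A B f X hX ▷ dual X ⊗≫ ((B.half.β U hU).inv ▷ (X ⊗ dual X) ≫
            (B.pt ⊗ U) ◁ evR X) ⊗≫ 𝟙 _ := by monoidal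
    _ = _ := by
      rw [whisker_exchange (A.σ U hU) (coev X), ← whisker_exchange (B.half.β U hU).inv (evR X)]
      conv_rhs => unfold conj avg
      monoidal

end RelCenter
end Averaging

section Maschke
variable {C : Type u} [Category.{v} C] [MonoidalCategory C] [Preadditive C]
  [MonoidalPreadditive C] {𝕜 : Type w} [Field 𝕜] [Linear 𝕜 C] [MonoidalLinear 𝕜 C]
  {P : ObjectProperty C} {I : Type w'} [Fintype I] [PivotalCategory C] [P.IsMonoidal]

namespace RelCenter

section Insert
variable {A B : RelCenter P} (f : A.pt ⟶ B.pt)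

variable (𝕜) in
/-- The partial trace over `X` of the conjugate of `f` by `U ⊗ X`, with an endomorphism of `U ⊗ X`
inserted on its way, as a linear map in the endomorphism. -/
def insertLeft (U X : C) (hU : P U) (hX : P X) :
    (U ⊗ X ⟶ U ⊗ X) →ₗ[𝕜] (A.pt ⊗ U ⟶ B.pt ⊗ U) where
  toFun g := 𝟙 _ ⊗≫ A.pt ◁ U ◁ coev X ⊗≫ conj A B f (U ⊗ X) (P.prop_tensor hU hX) ▷ dual X ⊗≫
    B.pt ◁ g ▷ dual X ⊗≫ B.pt ◁ U ◁ evR X ⊗≫ 𝟙 _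
  map_add' g h := by simp [monoidalComp]
  map_smul' c g := by simp [monoidalComp]

variable (𝕜) in
/-- The partial trace over `X` of the conjugate of `f` by `X`, with an endomorphism of `X^* ⊗ U`
inserted between the returning strand of the loop and a strand `U` to its right, as a linear map in
the endomorphism. -/
def insertRight (U X : C) (hX : P X) :
    (dual X ⊗ U ⟶ dual X ⊗ U) →ₗ[𝕜] (A.pt ⊗ U ⟶ B.pt ⊗ U) where
  toFun g := 𝟙 _ ⊗≫ A.pt ◁ coev X ▷ U ⊗≫ conj A B f X hX ▷ (dual X ⊗ U) ⊗≫
    (B.pt ⊗ X) ◁ g ⊗≫ B.pt ◁ evR X ▷ U ⊗≫ 𝟙 _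
  map_add' g h := by simp [monoidalComp]
  map_smul' c g := by simp [monoidalComp]

lemma insertLeft_id (U X : C) (hU : P U) (hX : P X) :
    insertLeft 𝕜 f U X hU hX (𝟙 _) = conj A B (avg A B f X hX) U hU := by
  rw [conj_avg f hU hX]
  simp only [insertLeft, LinearMap.coe_mk, AddHom.coe_mk]
  monoidal

lemma insertRight_id (U X : C) (hX : P X) :
    insertRight 𝕜 f U X hX (𝟙 _) = avg A B f X hX ▷ U := by
  simp only [insertRight, avg, LinearMap.coe_mk, AddHom.coe_mk]
  monoidal

lemma insertRight_rot {U X Y : C} (hU : P U) (hX : P X) (hY : P Y) (p : U ⊗ X ⟶ Y)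
    (i : Y ⟶ U ⊗ X) :
    insertRight 𝕜 f U Y hY (rotOut p ≫ rotIn i) = insertLeft 𝕜 f U X hU hX (p ≫ i) := by
  simp only [insertLeft, insertRight, LinearMap.coe_mk, AddHom.coe_mk]
  calc
    _ = 𝟙 _ ⊗≫ A.pt ◁ coev Y ▷ U ⊗≫ (conj A B f Y hY ▷ (dual Y ⊗ U) ≫
          (B.pt ⊗ Y) ◁ rotOut p) ⊗≫ B.pt ◁ (Y ◁ rotIn i ⊗≫ evR Y ▷ U) ⊗≫ 𝟙 _ := by monoidal
    _ = 𝟙 _ ⊗≫ A.pt ◁ (coev Y ▷ U ⊗≫ Y ◁ rotOut p) ⊗≫ conj A B f Y hY ▷ dual X ⊗≫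
          B.pt ◁ (Y ◁ rotIn i ⊗≫ evR Y ▷ U) ⊗≫ 𝟙 _ := by
        rw [← whisker_exchange]; monoidal
    _ = 𝟙 _ ⊗≫ A.pt ◁ U ◁ coev X ⊗≫ (A.pt ◁ p ≫ conj A B f Y hY) ▷ dual X ⊗≫
          B.pt ◁ (i ▷ dual X ⊗≫ U ◁ evR X) ⊗≫ 𝟙 _ := by
        rw [coev_rotOut, rotIn_evR]; monoidal
    _ = _ := by
        rw [conj_naturality f (P.prop_tensor hU hX) hY]; monoidal

end Insert

variable [DualStable P] (D : SimpleSystem 𝕜 P I) {d : I → 𝕜}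

-- Both sides expand over resolutions of the `U ⊗ S i`: a loop coloured by `S j` to the left of `U`
-- is a sum of loops around `U ⊗ S i` by `sum_rotOut_rotIn`.
lemma sum_avg_whiskerRight (hd : ∀ i, dimL (D.S i) = d i • 𝟙 (𝟙_ C)) (h1 : 𝟙 (𝟙_ C) ≠ 0)
    {A B : RelCenter P} (f : A.pt ⟶ B.pt) (U : C) (hU : P U) :
    (∑ i, d i • avg A B f (D.S i) (D.mem i)) ▷ U =
      conj A B (∑ i, d i • avg A B f (D.S i) (D.mem i)) U hU := by
  let R (i : I) : Resolution D.S (U ⊗ D.S i) := D.res _ (P.prop_tensor hU (D.mem i))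
  let loop (i : I) := insertLeft 𝕜 f U (D.S i) hU (D.mem i)
  have avg_eq (j : I) : d j • avg A B f (D.S j) (D.mem j) ▷ U =
      ∑ i, ∑ k, d i • loop i ((R i).π ⟨j, k⟩ ≫ (R i).ι ⟨j, k⟩) := by
    rw [← insertRight_id (𝕜 := 𝕜), ← map_smul, ← D.sum_rotOut_rotIn hd h1 hU R j]
    simp only [map_sum, map_smul, loop, insertRight_rot f hU (D.mem _) (D.mem j)]
  have conj_eq (i : I) : d i • conj A B (avg A B f (D.S i) (D.mem i)) U hU =
      ∑ j, ∑ k, d i • loop i ((R i).π ⟨j, k⟩ ≫ (R i).ι ⟨j, k⟩) := by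
    rw [← insertLeft_id (𝕜 := 𝕜), ← (R i).total, Fintype.sum_sigma]
    simp only [map_sum, Finset.smul_sum, loop]
  calc
    _ = ∑ j, ∑ i, ∑ k, d i • loop i ((R i).π ⟨j, k⟩ ≫ (R i).ι ⟨j, k⟩) := by
      simp only [sum_whiskerRight, MonoidalLinear.smul_whiskerRight, avg_eq]
    _ = ∑ i, d i • conj A B (avg A B f (D.S i) (D.mem i)) U hU := by
      rw [Finset.sum_comm]
      simp only [conj_eq]
    _ = _ := by simp [conj, Preadditive.sum_comp, Preadditive.comp_sum, whiskerLeft_sum]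

variable (hd : ∀ i, dimL (D.S i) = d i • 𝟙 (𝟙_ C)) (h1 : 𝟙 (𝟙_ C) ≠ 0)

/-- The average of a morphism of `C` is a morphism of the relative center. -/
def average {A B : RelCenter P} (f : A.pt ⟶ B.pt) : A ⟶ B where
  f := ∑ i, d i • avg A B f (D.S i) (D.mem i)
  comm U hU := by
    rw [sum_avg_whiskerRight D hd h1 f U hU]
    simp [conj, σ]

lemma hom_average {A' A B : RelCenter P} (g : A' ⟶ A) (f : A.pt ⟶ B.pt) :
    average D hd h1 (Hom.f g ≫ f) = g ≫ average D hd h1 f := by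
  apply hom_ext
  change ∑ i, d i • avg A' B (Hom.f g ≫ f) _ _ = Hom.f g ≫ ∑ i, d i • avg A B f _ _
  simp [hom_avg, Preadditive.comp_sum]

lemma average_hom_comp {A B B' : RelCenter P} (f : A.pt ⟶ B.pt) (g : B ⟶ B') :
    average D hd h1 (f ≫ Hom.f g) = average D hd h1 f ≫ g := by
  apply hom_ext
  change ∑ i, d i • avg A B' (f ≫ Hom.f g) _ _ = (∑ i, d i • avg A B f _ _) ≫ Hom.f g
  simp [avg_hom_comp, Preadditive.sum_comp]

lemma average_id {c : 𝕜} (hc : ∑ i, dimL (D.S i) ≫ dimR (D.S i) = c • 𝟙 (𝟙_ C))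
    (A : RelCenter P) : average D hd h1 (𝟙 A.pt) = c • 𝟙 A := by
  apply hom_ext
  change ∑ i, d i • avg A A (𝟙 A.pt) _ _ = c • 𝟙 A.pt
  simp only [avg_id]
  have : ∑ i, d i • ((ρ_ _).inv ≫ A.pt ◁ dimR (D.S i) ≫ (ρ_ _).hom) =
      (ρ_ _).inv ≫ A.pt ◁ (∑ i, dimL (D.S i) ≫ dimR (D.S i)) ≫ (ρ_ _).hom := by
    simp [hd, Preadditive.sum_comp, Preadditive.comp_sum, whiskerLeft_sum]
  rw [this, hc]
  simp

theorem isVonNeumannRegular (hd : ∀ i, dimL (D.S i) = d i • 𝟙 (𝟙_ C)) (h1 : 𝟙 (𝟙_ C) ≠ 0)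
    {c : 𝕜} (hc : ∑ i, dimL (D.S i) ≫ dimR (D.S i) = c • 𝟙 (𝟙_ C)) (hc0 : c ≠ 0)
    {A B : RelCenter P} (f : A ⟶ B) (hf : IsVonNeumannRegular (Hom.f f)) :
    IsVonNeumannRegular f := by
  obtain ⟨g, hg⟩ := hf
  refine ⟨c⁻¹ • average D hd h1 g, ?_⟩
  rw [Linear.smul_comp, Linear.comp_smul, ← average_hom_comp, ← hom_average, hg,
    ← Category.id_comp (Hom.f f), average_hom_comp, average_id D hd h1 hc, Linear.smul_comp,
    Category.id_comp, smul_smul, inv_mul_cancel₀ hc0, one_smul]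

end RelCenter
end Maschke

section ToRel
variable {C : Type u} [Category.{v} C] [MonoidalCategory C] [PivotalCategory C]
  {P : ObjectProperty C} [P.IsMonoidal] [DualStable P] {B : C}

/-- Over a class of objects stable under duality, lax half braidings are half braidings. -/
def LaxHalf.toRel (b : LaxHalf P B) : RelHalfBraiding P B where
  β U hU :=
    { hom := b.s U hU
      inv := b.rot (DualStable.prop_dual hU) (coevR U) (evR U)
      hom_inv_id := b.comp_rot hU _ _ _ (tri4 U)
      inv_hom_id := b.rot_comp hU _ _ _ (tri4 U) }
  naturality := b.nat
  monoidal := b.mul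

end ToRel

section Exchange
variable {C : Type u} [Category.{v} C] [MonoidalCategory C] [DualityData C] (X : C)

/-- The morphism `(Y ⊗ X ⊗ Y^*) ⊗ V ⟶ U ⊗ (Z ⊗ X ⊗ Z^*)` given by a morphism `Y ⟶ U ⊗ Z` and the
rotation of a morphism `V ⊗ Z ⟶ Y`. -/
def exch {U V Y Z : C} (i : Y ⟶ U ⊗ Z) (p : V ⊗ Z ⟶ Y) :
    ((Y ⊗ X) ⊗ dual Y) ⊗ V ⟶ U ⊗ ((Z ⊗ X) ⊗ dual Z) :=
  𝟙 _ ⊗≫ (Y ⊗ X) ◁ rotOut p ⊗≫ i ▷ X ▷ dual Z ⊗≫ 𝟙 _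

lemma whiskerLeft_exch {U V V' Y Z : C} (f : V' ⟶ V) (i : Y ⟶ U ⊗ Z) (p : V ⊗ Z ⟶ Y) :
    ((Y ⊗ X) ⊗ dual Y) ◁ f ≫ exch X i p = exch X i (f ▷ Z ≫ p) := by
  unfold exch
  rw [rotOut_comp_left]
  monoidal

lemma exch_whiskerRight {U U' V Y Z : C} (f : U ⟶ U') (i : Y ⟶ U ⊗ Z) (p : V ⊗ Z ⟶ Y) :
    exch X i p ≫ f ▷ ((Z ⊗ X) ⊗ dual Z) = exch X (i ≫ f ▷ Z) p := by
  unfold exch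
  monoidal

lemma exch_comp {U U' V V' Y L Z : C} (i : Y ⟶ U ⊗ L) (p : U' ⊗ L ⟶ Y) (i' : L ⟶ V ⊗ Z)
    (p' : V' ⊗ Z ⟶ L) :
    exch X i p ▷ V' ≫ (α_ _ _ _).hom ≫ U ◁ exch X i' p' ≫ (α_ _ _ _).inv =
      (α_ _ _ _).hom ≫ exch X (i ≫ U ◁ i' ≫ (α_ _ _ _).inv)
        (((α_ _ _ _).hom ≫ U' ◁ p') ≫ p) := by
  have h : rotOut p ▷ V' ≫ rotOut p' = _ := rotOut_comp_rotOut p p'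
  rw [Category.assoc]
  calc
    _ = 𝟙 _ ⊗≫ (Y ⊗ X) ◁ rotOut p ▷ V' ⊗≫ ((i ▷ X) ▷ (dual L ⊗ V') ≫
          ((U ⊗ L) ⊗ X) ◁ rotOut p') ⊗≫ U ◁ i' ▷ X ▷ dual Z ⊗≫ 𝟙 _ := by
        unfold exch; monoidal
    _ = 𝟙 _ ⊗≫ (Y ⊗ X) ◁ (rotOut p ▷ V' ≫ rotOut p') ⊗≫ i ▷ X ▷ dual Z ⊗≫
          U ◁ i' ▷ X ▷ dual Z ⊗≫ 𝟙 _ := by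
        rw [← whisker_exchange]; monoidal
    _ = _ := by
        rw [h]; unfold exch; monoidal

lemma exch_leftUnitor (Y : C) :
    exch X (λ_ Y).inv (λ_ Y).hom = (ρ_ _).hom ≫ (λ_ _).inv := by
  unfold exch
  rw [rotOut_leftUnitor]
  monoidal

variable [Preadditive C] [MonoidalPreadditive C] (𝕜 : Type w) [Field 𝕜] [Linear 𝕜 C]
  [MonoidalLinear 𝕜 C]

/-- `exch` as a bilinear map. -/
def exchₗ (U V Y Z : C) : (Y ⟶ U ⊗ Z) →ₗ[𝕜] (V ⊗ Z ⟶ Y) →ₗ[𝕜]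
    (((Y ⊗ X) ⊗ dual Y) ⊗ V ⟶ U ⊗ ((Z ⊗ X) ⊗ dual Z)) :=
  LinearMap.mk₂ 𝕜 (exch X) (fun _ _ _ => by simp [exch, monoidalComp])
    (fun _ _ _ => by simp [exch, monoidalComp])
    (fun _ _ _ => by simp [exch, rotOut, monoidalComp])
    (fun _ _ _ => by simp [exch, rotOut, monoidalComp])

@[simp] lemma exchₗ_apply {U V Y Z : C} (i : Y ⟶ U ⊗ Z) (p : V ⊗ Z ⟶ Y) :
    exchₗ X 𝕜 U V Y Z i p = exch X i p := rfl

end Exchange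

section Induction
variable {C : Type u} [Category.{v} C] [MonoidalCategory C] [Preadditive C]
  [MonoidalPreadditive C] {𝕜 : Type w} [Field 𝕜] [Linear 𝕜 C] {P : ObjectProperty C}
  {I : Type w'} [Fintype I] [DualityData C] [P.IsMonoidal]
  (D : SimpleSystem 𝕜 P I) {X F : C} (s : Splitting F fun i => (D.S i ⊗ X) ⊗ dual (D.S i))

namespace SimpleSystem

/-- The chosen resolution of `U ⊗ S i`. -/
def resTensor (U : C) (hU : P U) (i : I) : Resolution D.S (U ⊗ D.S i) :=
  D.res _ (P.prop_tensor hU (D.mem i))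

/-- The component at `i` of the half braiding of the induced object: the sum of the exchanges along
a resolution of `U ⊗ S i`. -/
def indComp (U : C) (hU : P U) (i : I) : F ⊗ U ⟶ U ⊗ ((D.S i ⊗ X) ⊗ dual (D.S i)) :=
  ∑ x, s.π x.1 ▷ U ≫ exch X ((D.resTensor U hU i).ι x) ((D.resTensor U hU i).π x)

/-- The half braiding of the induced object `F = ⨁ i, (S i ⊗ X) ⊗ (S i)^*`. -/
def indHom (U : C) (hU : P U) : F ⊗ U ⟶ U ⊗ F :=
  (s.whiskerLeft U).lift (D.indComp s U hU)

lemma indHom_π (U : C) (hU : P U) (i : I) :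
    D.indHom s U hU ≫ U ◁ s.π i = D.indComp s U hU i :=
  (s.whiskerLeft U).lift_π _ i

variable [MonoidalLinear 𝕜 C]

lemma indHom_naturality {U V : C} (hU : P U) (hV : P V) (f : U ⟶ V) :
    F ◁ f ≫ D.indHom s V hV = D.indHom s U hU ≫ f ▷ F := by
  refine (s.whiskerLeft V).hom_ext_left fun i => ?_
  have h := D.dinatural (D.resTensor U hU i) (D.resTensor V hV i) (f ▷ D.S i)
    (fun j => (exchₗ X 𝕜 V U (D.S j) (D.S i)).compr₂ (Linear.leftComp 𝕜 _ (s.π j ▷ U)))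
  simp only [LinearMap.compr₂_apply, exchₗ_apply, Linear.leftComp_apply, ← exch_whiskerRight,
    ← whiskerLeft_exch] at h
  calc
    _ = F ◁ f ≫ D.indComp s V hV i := by
      rw [Splitting.whiskerLeft_π, Category.assoc, indHom_π]
    _ = D.indComp s U hU i ≫ f ▷ _ := by
      simp only [indComp, Preadditive.comp_sum, Preadditive.sum_comp, Category.assoc, h,
        whisker_exchange_assoc]
    _ = _ := by
      rw [Splitting.whiskerLeft_π, Category.assoc, ← whisker_exchange, ← Category.assoc, indHom_π]

lemma indHom_one : D.indHom s (𝟙_ C) P.prop_unit = (ρ_ F).hom ≫ (λ_ F).inv := by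
  refine (s.whiskerLeft _).hom_ext_left fun i => ?_
  have h := D.sum_bilin_eq_of_iso (D.resTensor (𝟙_ C) P.prop_unit i) (λ_ (D.S i))
    (fun j => (exchₗ X 𝕜 (𝟙_ C) (𝟙_ C) (D.S j) (D.S i)).compr₂
      (Linear.leftComp 𝕜 _ (s.π j ▷ 𝟙_ C)))
  simp only [LinearMap.compr₂_apply, exchₗ_apply, Linear.leftComp_apply, exch_leftUnitor] at h
  rw [Splitting.whiskerLeft_π, indHom_π, indComp, h]
  simp

-- Dinaturality trades the resolution of `U ⊗ S l` for that of `(U ⊗ V) ⊗ S r`.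
lemma indHom_comp_exch {U V : C} (hU : P U) {l r : I} (i : D.S l ⟶ V ⊗ D.S r)
    (p : V ⊗ D.S r ⟶ D.S l) (R : Resolution D.S ((U ⊗ V) ⊗ D.S r)) :
    (α_ _ _ _).inv ≫ D.indHom s U hU ▷ V ≫ (α_ _ _ _).hom ≫ U ◁ (s.π l ▷ V ≫ exch X i p) ≫
        (α_ _ _ _).inv =
      ∑ x, s.π x.1 ▷ (U ⊗ V) ≫ exch X (R.ι x)
        ((α_ _ _ _).hom ≫ U ◁ (p ≫ i) ≫ (α_ _ _ _).inv ≫ R.π x) := by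
  have h := D.dinatural (D.resTensor U hU l) R (U ◁ i ≫ (α_ _ _ _).inv)
    (fun j => ((exchₗ X 𝕜 (U ⊗ V) (U ⊗ V) (D.S j) (D.S r)).compl₂
      (Linear.leftComp 𝕜 _ ((α_ _ _ _).hom ≫ U ◁ p))).compr₂
      (Linear.leftComp 𝕜 _ (s.π j ▷ (U ⊗ V))))
  simp only [LinearMap.compr₂_apply, LinearMap.compl₂_apply, exchₗ_apply,
    Linear.leftComp_apply] at h
  calc
    _ = (α_ _ _ _).inv ≫ (D.indHom s U hU ≫ U ◁ s.π l) ▷ V ≫ (α_ _ _ _).hom ≫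
          U ◁ exch X i p ≫ (α_ _ _ _).inv := by simp
    _ = ∑ x, s.π x.1 ▷ (U ⊗ V) ≫ exch X ((D.resTensor U hU l).ι x ≫ U ◁ i ≫ (α_ _ _ _).inv)
          (((α_ _ _ _).hom ≫ U ◁ p) ≫ (D.resTensor U hU l).π x) := by
      rw [indHom_π]
      simp only [indComp, sum_whiskerRight, Preadditive.comp_sum, Preadditive.sum_comp,
        comp_whiskerRight, Category.assoc, exch_comp]
      simp
    _ = _ := by
      rw [h]
      simp

lemma indHom_tensor (U V : C) (hU : P U) (hV : P V) :
    D.indHom s (U ⊗ V) (P.prop_tensor hU hV) =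
      (α_ _ _ _).inv ≫ D.indHom s U hU ▷ V ≫ (α_ _ _ _).hom ≫ U ◁ D.indHom s V hV ≫
        (α_ _ _ _).inv := by
  refine (s.whiskerLeft _).hom_ext_left fun i => ?_
  let R := D.resTensor V hV i
  let R' := D.resTensor (U ⊗ V) (P.prop_tensor hU hV) i
  have π_eq (x) : R'.π x =
      ∑ y, (α_ _ _ _).hom ≫ U ◁ (R.π y ≫ R.ι y) ≫ (α_ _ _ _).inv ≫ R'.π x := by
    simp only [← Preadditive.comp_sum, ← Preadditive.sum_comp, ← whiskerLeft_sum, R.total]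
    simp
  have exch_eq (x) : exch X (R'.ι x) (R'.π x) = ∑ y, exch X (R'.ι x)
      ((α_ _ _ _).hom ≫ U ◁ (R.π y ≫ R.ι y) ≫ (α_ _ _ _).inv ≫ R'.π x) :=
    (congrArg (exchₗ X 𝕜 _ _ _ _ (R'.ι x)) (π_eq x)).trans (map_sum _ _ _)
  symm
  calc
    _ = (α_ _ _ _).inv ≫ D.indHom s U hU ▷ V ≫ (α_ _ _ _).hom ≫ U ◁ D.indComp s V hV i ≫
          (α_ _ _ _).inv := by
      rw [← indHom_π]
      simp
    _ = ∑ y, ∑ x, s.π x.1 ▷ (U ⊗ V) ≫ exch X (R'.ι x)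
          ((α_ _ _ _).hom ≫ U ◁ (R.π y ≫ R.ι y) ≫ (α_ _ _ _).inv ≫ R'.π x) := by
      simp only [← D.indHom_comp_exch s hU, indComp, whiskerLeft_sum, Preadditive.comp_sum,
        Preadditive.sum_comp, R]
    _ = ∑ x, s.π x.1 ▷ (U ⊗ V) ≫ exch X (R'.ι x) (R'.π x) := by
      rw [Finset.sum_comm]
      simp only [exch_eq, Preadditive.comp_sum]
    _ = _ := (D.indHom_π s _ _ i).symm

end SimpleSystem
end Induction

section Unit
variable {C : Type u} [Category.{v} C] [MonoidalCategory C] {P : ObjectProperty C} [P.IsMonoidal]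

namespace RelCenter
variable {A : RelCenter P} {X : C} (f : A.pt ⟶ X)

section
variable [DualityData C]

/-- The morphism `A ⟶ Z ⊗ X ⊗ Z^*` obtained from `f : A ⟶ X` and the half braiding of `A`. -/
def wrap (Z : C) (hZ : P Z) : A.pt ⟶ (Z ⊗ X) ⊗ dual Z :=
  𝟙 _ ⊗≫ A.pt ◁ coev Z ⊗≫ (A.σ Z hZ ≫ Z ◁ f) ▷ dual Z

lemma wrap_ev (Z : C) (hZ : P Z) :
    wrap f Z hZ ▷ Z ≫ (α_ _ _ _).hom ≫ (Z ⊗ X) ◁ ev Z ≫ (ρ_ _).hom = A.σ Z hZ ≫ Z ◁ f := by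
  unfold wrap
  calc
    _ = 𝟙 _ ⊗≫ A.pt ◁ coev Z ▷ Z ⊗≫ ((A.σ Z hZ ≫ Z ◁ f) ▷ (dual Z ⊗ Z) ≫
          (Z ⊗ X) ◁ ev Z) ⊗≫ 𝟙 _ := by monoidal
    _ = 𝟙 _ ⊗≫ A.pt ◁ (coev Z ▷ Z ⊗≫ Z ◁ ev Z) ⊗≫ (A.σ Z hZ ≫ Z ◁ f) ⊗≫ 𝟙 _ := by
        rw [← whisker_exchange]; monoidal
    _ = _ := by rw [tri1]; monoidal

lemma wrap_exch {U Z Y : C} (hU : P U) (hZ : P Z) (hY : P Y) (i : Y ⟶ U ⊗ Z) (p : U ⊗ Z ⟶ Y) :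
    wrap f Y hY ▷ U ≫ exch X i p =
      𝟙 _ ⊗≫ A.pt ◁ U ◁ coev Z ⊗≫ A.pt ◁ (p ≫ i) ▷ dual Z ⊗≫
        (A.σ (U ⊗ Z) (P.prop_tensor hU hZ) ≫ (U ⊗ Z) ◁ f) ▷ dual Z ⊗≫ 𝟙 _ := by
  unfold wrap exch
  have h : A.pt ◁ i ≫ A.σ (U ⊗ Z) (P.prop_tensor hU hZ) = A.σ Y hY ≫ i ▷ A.pt :=
    A.half.naturality hY (P.prop_tensor hU hZ) i
  calc
    _ = 𝟙 _ ⊗≫ A.pt ◁ coev Y ▷ U ⊗≫ ((A.σ Y hY ≫ Y ◁ f) ▷ (dual Y ⊗ U) ≫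
          (Y ⊗ X) ◁ rotOut p) ⊗≫ i ▷ X ▷ dual Z ⊗≫ 𝟙 _ := by monoidal
    _ = 𝟙 _ ⊗≫ A.pt ◁ (coev Y ▷ U ⊗≫ Y ◁ rotOut p) ⊗≫ (A.σ Y hY ≫
          (Y ◁ f ≫ i ▷ X)) ▷ dual Z ⊗≫ 𝟙 _ := by
        rw [← whisker_exchange]; monoidal
    _ = 𝟙 _ ⊗≫ A.pt ◁ U ◁ coev Z ⊗≫ A.pt ◁ p ▷ dual Z ⊗≫ ((A.σ Y hY ≫ i ▷ A.pt) ≫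
          (U ⊗ Z) ◁ f) ▷ dual Z ⊗≫ 𝟙 _ := by
        rw [coev_rotOut, whisker_exchange]; monoidal
    _ = _ := by rw [← h]; monoidal

lemma σ_wrap {U Z : C} (hU : P U) (hZ : P Z) :
    A.σ U hU ≫ U ◁ wrap f Z hZ =
      𝟙 _ ⊗≫ A.pt ◁ U ◁ coev Z ⊗≫
        (A.σ (U ⊗ Z) (P.prop_tensor hU hZ) ≫ (U ⊗ Z) ◁ f) ▷ dual Z ⊗≫ 𝟙 _ := by
  unfold wrap
  have hm : A.σ (U ⊗ Z) (P.prop_tensor hU hZ) = (α_ _ _ _).inv ≫ A.σ U hU ▷ Z ≫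
      (α_ _ _ _).hom ≫ U ◁ A.σ Z hZ ≫ (α_ _ _ _).inv := A.half.monoidal U Z hU hZ
  rw [hm]
  calc
    _ = 𝟙 _ ⊗≫ (A.σ U hU ▷ 𝟙_ C ≫ (U ⊗ A.pt) ◁ coev Z) ⊗≫
          U ◁ (A.σ Z hZ ≫ Z ◁ f) ▷ dual Z ⊗≫ 𝟙 _ := by monoidal
    _ = _ := by rw [← whisker_exchange]; monoidal

end

section
variable [Preadditive C] [MonoidalPreadditive C] {𝕜 : Type w} [Field 𝕜] [Linear 𝕜 C]
  {I : Type w'} [Fintype I] [DualityData C]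
  (D : SimpleSystem 𝕜 P I) {F : C} (s : Splitting F fun i => (D.S i ⊗ X) ⊗ dual (D.S i))

lemma sum_wrap_exch {U Z : C} (hU : P U) (hZ : P Z) (R : Resolution D.S (U ⊗ Z)) :
    ∑ x, wrap f (D.S x.1) (D.mem x.1) ▷ U ≫ exch X (R.ι x) (R.π x) =
      A.σ U hU ≫ U ◁ wrap f Z hZ := by
  simp only [wrap_exch f hU hZ (D.mem _), σ_wrap f hU hZ]
  have h : A.pt ◁ 𝟙 (U ⊗ Z) ▷ dual Z = ∑ x, A.pt ◁ (R.π x ≫ R.ι x) ▷ dual Z := by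
    simp only [← whiskerLeft_sum, ← sum_whiskerRight, R.total]
  calc
    _ = 𝟙 _ ⊗≫ A.pt ◁ U ◁ coev Z ⊗≫ (∑ x, A.pt ◁ (R.π x ≫ R.ι x) ▷ dual Z) ⊗≫
        (A.σ (U ⊗ Z) (P.prop_tensor hU hZ) ≫ (U ⊗ Z) ◁ f) ▷ dual Z ⊗≫ 𝟙 _ := by
      simp [monoidalComp, Preadditive.sum_comp, Preadditive.comp_sum]
    _ = _ := by
      rw [← h]
      monoidal

/-- The morphism into the induced object with components `wrap f (S i)`. -/
def wrapSum : A.pt ⟶ F := s.lift fun i => wrap f (D.S i) (D.mem i)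

lemma wrapSum_comm (U : C) (hU : P U) :
    wrapSum f D s ▷ U ≫ D.indHom s U hU = A.σ U hU ≫ U ◁ wrapSum f D s := by
  refine (s.whiskerLeft U).hom_ext_left fun i => ?_
  calc
    _ = wrapSum f D s ▷ U ≫ D.indComp s U hU i := by
      rw [Splitting.whiskerLeft_π, Category.assoc, D.indHom_π]
    _ = A.σ U hU ≫ U ◁ wrap f (D.S i) (D.mem i) := by
      rw [← sum_wrap_exch f D hU (D.mem i) (D.resTensor U hU i)]
      simp only [SimpleSystem.indComp, Preadditive.comp_sum, wrapSum, ← comp_whiskerRight_assoc,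
        s.lift_π]
    _ = _ := by
      rw [Splitting.whiskerLeft_π, Category.assoc, ← MonoidalCategory.whiskerLeft_comp, wrapSum,
        s.lift_π]

end
end RelCenter

end Unit

section Induced
variable {C : Type u} [Category.{v} C] [MonoidalCategory C] [Preadditive C]
  [MonoidalPreadditive C] {𝕜 : Type w} [Field 𝕜] [Linear 𝕜 C] [MonoidalLinear 𝕜 C]
  {P : ObjectProperty C} [P.IsMonoidal] {I : Type w'} [Fintype I] [PivotalCategory C]
  [DualStable P] (D : SimpleSystem 𝕜 P I) {X F : C}
  (s : Splitting F fun i => (D.S i ⊗ X) ⊗ dual (D.S i))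

/-- The object of the relative center induced from `X`, with underlying object
`⨁ i, (S i ⊗ X) ⊗ (S i)^*`. -/
def SimpleSystem.induced : RelCenter P where
  pt := F
  half := LaxHalf.toRel
    { s := D.indHom s
      nat := D.indHom_naturality s
      mul := D.indHom_tensor s
      one := D.indHom_one s }

/-- The morphism of the relative center into the object induced from `X` that corresponds to a
morphism `f` of `C` into `X`. -/
def RelCenter.toInduced {A : RelCenter P} (f : A.pt ⟶ X) : A ⟶ D.induced s where
  f := wrapSum f D s
  comm := wrapSum_comm f D s

end Induced

section Cancel
variable {C : Type u} [Category.{v} C] [MonoidalCategory C] [Preadditive C]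
  [MonoidalPreadditive C] {𝕜 : Type w} [Field 𝕜] [Linear 𝕜 C] [MonoidalLinear 𝕜 C]
  [PivotalCategory C]

-- Closing the strand `Z` to a loop turns `Z ◁ f` into `d • f`.
lemma eq_zero_of_whiskerLeft {X Y Z : C} {d : 𝕜} (hd : dimL Z = d • 𝟙 (𝟙_ C)) (hd0 : d ≠ 0)
    {f : X ⟶ Y} (hf : Z ◁ f = 0) : f = 0 := by
  have h : (λ_ _).inv ≫ coevR Z ▷ X ≫ (α_ _ _ _).hom ≫ dual Z ◁ Z ◁ f ≫ (α_ _ _ _).inv ≫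
      ev Z ▷ Y ≫ (λ_ _).hom = d • f := by
    calc
      _ = 𝟙 _ ⊗≫ dimL Z ▷ X ⊗≫ f := by
        simp only [dimL, trL]
        calc
          _ = 𝟙 _ ⊗≫ coevR Z ▷ X ⊗≫ ((dual Z ⊗ Z) ◁ f ≫ ev Z ▷ Y) ⊗≫ 𝟙 _ := by monoidal
          _ = _ := by rw [whisker_exchange]; monoidal
      _ = _ := by rw [hd]; simp [monoidalComp]
  rw [hf] at h
  simp only [MonoidalPreadditive.whiskerLeft_zero, zero_comp, comp_zero] at h
  exact (smul_eq_zero.1 h.symm).resolve_left hd0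

lemma eq_zero_of_whiskerRight_dual {X Y Z : C} {d : 𝕜} (hd : dimL Z = d • 𝟙 (𝟙_ C)) (hd0 : d ≠ 0)
    {f : X ⟶ Y} (hf : f ▷ dual Z = 0) : f = 0 := by
  have h : (ρ_ _).inv ≫ X ◁ coevR Z ≫ (α_ _ _ _).inv ≫ f ▷ dual Z ▷ Z ≫ (α_ _ _ _).hom ≫
      Y ◁ ev Z ≫ (ρ_ _).hom = d • f := by
    calc
      _ = 𝟙 _ ⊗≫ X ◁ dimL Z ⊗≫ f := by
        simp only [dimL, trL]
        calc
          _ = 𝟙 _ ⊗≫ X ◁ coevR Z ⊗≫ (f ▷ (dual Z ⊗ Z) ≫ Y ◁ ev Z) ⊗≫ 𝟙 _ := by monoidal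
          _ = _ := by rw [← whisker_exchange]; monoidal
      _ = _ := by rw [hd]; simp [monoidalComp]
  rw [hf] at h
  simp only [MonoidalPreadditive.zero_whiskerRight, zero_comp, comp_zero] at h
  exact (smul_eq_zero.1 h.symm).resolve_left hd0

end Cancel

namespace RelCenter
variable {C : Type u} [Category.{v} C] [MonoidalCategory C] [Preadditive C]
  [MonoidalPreadditive C] {𝕜 : Type w} [Field 𝕜] [Linear 𝕜 C] [MonoidalLinear 𝕜 C]
  {P : ObjectProperty C} {I : Type w'} [Fintype I] [PivotalCategory C] [P.IsMonoidal]
  [DualStable P] (D : SimpleSystem 𝕜 P I) {X F : C}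
  (s : Splitting F fun i => (D.S i ⊗ X) ⊗ dual (D.S i)) {i : I} {d : 𝕜}

lemma toInduced_ne_zero (hd : dimL (D.S i) = d • 𝟙 (𝟙_ C)) (hd0 : d ≠ 0) {A : RelCenter P}
    {f : A.pt ⟶ X} (hf : f ≠ 0) : toInduced D s f ≠ 0 := by
  intro h
  have hwrap : wrap f (D.S i) (D.mem i) = 0 := by
    have h0 : wrapSum f D s = 0 := congrArg Hom.f h
    rw [← s.lift_π (fun i => wrap f (D.S i) (D.mem i)) i, ← wrapSum, h0, zero_comp]
  have hev := wrap_ev f (D.S i) (D.mem i)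
  rw [hwrap, MonoidalPreadditive.zero_whiskerRight, zero_comp] at hev
  refine hf (eq_zero_of_whiskerLeft hd hd0 ?_)
  rw [← cancel_epi (A.half.β (D.S i) (D.mem i)).hom, comp_zero]
  exact hev.symm

lemma id_induced_ne_zero (hd : dimL (D.S i) = d • 𝟙 (𝟙_ C)) (hd0 : d ≠ 0) (hX : 𝟙 X ≠ 0) :
    𝟙 (D.induced s) ≠ 0 := by
  intro h
  have hF : 𝟙 F = 0 := congrArg Hom.f h
  have hsummand : 𝟙 ((D.S i ⊗ X) ⊗ dual (D.S i)) = 0 := by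
    rw [← s.ι_π_self i, ← Category.id_comp (s.π i), hF, zero_comp, comp_zero]
  refine hX (eq_zero_of_whiskerLeft hd hd0 (eq_zero_of_whiskerRight_dual hd hd0 ?_))
  simpa using hsummand

end RelCenter

section Representatives
variable {C : Type u} [Category.{v} C] [Preadditive C]

lemma Splitting.nonempty_resolution {I : Type*} [Fintype I] {J : Type} [Fintype J] {W : C}
    {f : J → C} (s : Splitting W f) {S : I → C} (h : ∀ k, ∃ i, Nonempty (f k ≅ S i)) :
    Nonempty (Resolution S W) := by
  classical
  choose c e using h
  exact ⟨{
    mult := fun i => {k // c k = i}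
    ι := fun ⟨_, k, rfl⟩ => (e k).some.inv ≫ s.ι k
    π := fun ⟨_, k, rfl⟩ => s.π k ≫ (e k).some.hom
    total := (Fintype.sum_equiv (Equiv.sigmaFiberEquiv c) _ (fun k => s.π k ≫ s.ι k)
      fun ⟨_, k, rfl⟩ => by simp [Equiv.sigmaFiberEquiv]).trans s.total }⟩

variable {𝕜 : Type w} [Field 𝕜] [Linear 𝕜 C]

lemma simpleRep_mem {P : ObjectProperty C} (c : simpleClasses 𝕜 P) : P (simpleRep 𝕜 P c) :=
  c.2.choose_spec.1

lemma isSimpleObj_simpleRep {P : ObjectProperty C} (c : simpleClasses 𝕜 P) :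
    IsSimpleObj 𝕜 (simpleRep 𝕜 P c) := c.2.choose_spec.2.1

lemma mk_simpleRep {P : ObjectProperty C} (c : simpleClasses 𝕜 P) :
    Quotient.mk (isIsomorphicSetoid C) (simpleRep 𝕜 P c) = c := c.2.choose_spec.2.2

lemma exists_iso_simpleRep {P : ObjectProperty C} {S : C} (hP : P S) (hS : IsSimpleObj 𝕜 S) :
    ∃ c : simpleClasses 𝕜 P, Nonempty (S ≅ simpleRep 𝕜 P c) :=
  let c : simpleClasses 𝕜 P := ⟨Quotient.mk _ S, S, hP, hS, rfl⟩
  ⟨c, Quotient.exact (mk_simpleRep c).symm⟩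

variable [MonoidalCategory C] {G : Type w'} [Group G] {grading : G → ObjectProperty C}
  [IsGGraded grading] {α : G}

lemma exists_iso_simpleRep_of_retract {S X : C} (hX : grading α X) (hS : IsSimpleObj 𝕜 S)
    (r : Retract S X) : ∃ c : simpleClasses 𝕜 (grading α), Nonempty (S ≅ simpleRep 𝕜 _ c) := by
  obtain ⟨Y, hY, ⟨e⟩⟩ := exists_iso_of_retract hX r
  obtain ⟨c, ⟨e'⟩⟩ := exists_iso_simpleRep hY (hS.of_iso e)
  exact ⟨c, ⟨e ≪≫ e'⟩⟩

namespace IsSplitSemisimple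

/-- The chosen representatives of the simple objects of `C_α`. -/
def simpleSystem (h : IsSplitSemisimple C 𝕜) (grading : G → ObjectProperty C) [IsGGraded grading]
    (α : G) [Fintype (simpleClasses 𝕜 (grading α))] :
    SimpleSystem 𝕜 (grading α) (simpleClasses 𝕜 (grading α)) where
  S := simpleRep 𝕜 (grading α)
  mem := simpleRep_mem
  simple := isSimpleObj_simpleRep
  hom_eq_zero {c c'} hcc' f := by
    by_contra hf
    obtain e := h.nonempty_iso (isSimpleObj_simpleRep c) (isSimpleObj_simpleRep c') hf
    refine hcc' (Subtype.ext ?_)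
    rw [← mk_simpleRep c, ← mk_simpleRep c']
    exact Quotient.sound e
  res W hW := Nonempty.some <| by
    obtain ⟨n, f, hf, ⟨s⟩⟩ := h.exists_splitting W
    exact s.nonempty_resolution fun k => exists_iso_simpleRep_of_retract hW (hf k) (s.retract k)

lemma exists_hom_simpleRep_ne_zero (h : IsSplitSemisimple C 𝕜) {X : C} (hX : grading α X)
    (hX0 : 𝟙 X ≠ 0) :
    ∃ (c : simpleClasses 𝕜 (grading α)) (f : X ⟶ simpleRep 𝕜 (grading α) c), f ≠ 0 := by
  obtain ⟨S, a, b, hS, hab⟩ := h.exists_simple_retract hX0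
  rw [Category.id_comp] at hab
  obtain ⟨c, ⟨e⟩⟩ := exists_iso_simpleRep_of_retract hX hS ⟨a, b, hab⟩
  refine ⟨c, b ≫ e.hom, fun hb => hS.id_ne_zero ?_⟩
  rw [← hab, (cancel_mono e.hom).1 (hb.trans zero_comp.symm), comp_zero]

lemma exists_simple_mem (h : IsSplitSemisimple C 𝕜) {X : C} (hX : grading α X) (hX0 : 𝟙 X ≠ 0) :
    ∃ S, grading α S ∧ IsSimpleObj 𝕜 S :=
  have ⟨c, _⟩ := h.exists_hom_simpleRep_ne_zero hX hX0
  ⟨simpleRep 𝕜 _ c, simpleRep_mem c, isSimpleObj_simpleRep c⟩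

end IsSplitSemisimple
end Representatives

section Finiteness
variable {C : Type u} [Category.{v} C] [Preadditive C] {𝕜 : Type w} [Field 𝕜] [Linear 𝕜 C]

lemma IsSplitSemisimple.finite_simpleClasses (h : IsSplitSemisimple C 𝕜) {P : ObjectProperty C}
    {J : Type*} [Finite J] (F : J → C)
    (hF : ∀ X, P X → IsSimpleObj 𝕜 X → ∃ (j : J) (f : X ⟶ F j), f ≠ 0) :
    (simpleClasses 𝕜 P).Finite := by
  choose n T hT s using fun j => h.exists_splitting (F j)
  refine (Set.finite_range fun p : Σ j, Fin (n j) =>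
    Quotient.mk (isIsomorphicSetoid C) (T p.1 p.2)).subset ?_
  rintro _ ⟨X, hPX, hX, rfl⟩
  obtain ⟨j, f, hf⟩ := hF X hPX hX
  obtain ⟨k, hk⟩ : ∃ k, f ≫ (s j).some.π k ≠ 0 := by
    by_contra! H
    exact hf ((s j).some.hom_ext_left fun k => by rw [H, zero_comp])
  obtain ⟨e⟩ := h.nonempty_iso hX (hT j k) hk
  exact ⟨⟨j, k⟩, Quotient.sound ⟨e.symm⟩⟩

end Finiteness

namespace RelCenter
variable {𝕜 : Type w} [Field 𝕜] {C : Type u} [Category.{v} C] [MonoidalCategory C]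
  {P : ObjectProperty C} [P.IsMonoidal] [Preadditive C] [MonoidalPreadditive C] [Linear 𝕜 C]
  [MonoidalLinear 𝕜 C]

lemma finite_hom (A B : RelCenter P) [Module.Finite 𝕜 (A.pt ⟶ B.pt)] : Module.Finite 𝕜 (A ⟶ B) :=
  Module.Finite.of_injective
    ({ toFun := fun f => Hom.f f, map_add' := fun _ _ => rfl, map_smul' := fun _ _ => rfl } :
      (A ⟶ B) →ₗ[𝕜] (A.pt ⟶ B.pt)) fun _ _ h => hom_ext h

lemma isSimpleObj_unit (h : IsSimpleObj 𝕜 (𝟙_ C)) : IsSimpleObj 𝕜 (𝟙_ (RelCenter P)) := by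
  refine isSimpleObj_of_exists_smul (fun h0 => h.id_ne_zero (congrArg Hom.f h0)) fun f => ?_
  obtain ⟨c, hc⟩ := h.exists_smul (Hom.f f)
  exact ⟨c, hom_ext hc⟩

end RelCenter

section Dimension
variable {C : Type u} [Category.{v} C] [MonoidalCategory C] [Preadditive C] [PivotalCategory C]
  {𝕜 : Type w} [Field 𝕜] [Linear 𝕜 C]

lemma exists_dimL_ne_zero {P : ObjectProperty C} (h1 : IsSimpleObj 𝕜 (𝟙_ C))
    (hdim : dimension 𝕜 P ≠ 0) :
    ∃ (c : simpleClasses 𝕜 P) (d : 𝕜), dimL (simpleRep 𝕜 P c) = d • 𝟙 (𝟙_ C) ∧ d ≠ 0 := by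
  by_contra! H
  refine hdim (finsum_eq_zero_of_forall_eq_zero fun c => ?_)
  obtain ⟨d, hd⟩ := h1.exists_smul (dimL (simpleRep 𝕜 P c))
  rw [hd, H c d hd, zero_smul, zero_comp]

end Dimension

section Fusion
variable {𝕜 : Type w} [Field 𝕜] {C : Type u} [Category.{v} C] [MonoidalCategory C]
  [Preadditive C] [Linear 𝕜 C] [PivotalCategory C] {G : Type w'} [Group G]
  {grading : G → ObjectProperty C} [IsPivotalGraded grading]

lemma SimpleSystem.exists_splitting {I : Type*} [Fintype I] (D : SimpleSystem 𝕜 (grading 1) I)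
    {α : G} {X : C} (hX : grading α X) :
    ∃ F, grading α F ∧ Nonempty (Splitting F fun i => (D.S i ⊗ X) ⊗ dual (D.S i)) :=
  exists_splitting_mem _ fun i => IsGGraded.tensor_one (IsGGraded.one_tensor hX (D.mem i))
    (DualStable.prop_dual (D.mem i))

namespace IsGFusion
variable [MonoidalPreadditive C] [MonoidalLinear 𝕜 C]

theorem isSplitSemisimple_center [IsAlgClosed 𝕜] (hC : IsGFusion 𝕜 grading)
    (hdim : dimension 𝕜 (grading 1) ≠ 0) : IsSplitSemisimple (GCenter grading) 𝕜 := by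
  have := IsGGraded.hasFiniteBiproducts (grading := grading)
  have : Fintype (simpleClasses 𝕜 (grading 1)) := (hC.finite_simple 1).fintype
  have hss := hC.splitSemisimple
  have := hss.isIdempotentComplete
  let D := hss.simpleSystem grading 1
  choose d hd using fun i => hC.unit_simple.exists_smul (dimL (D.S i))
  obtain ⟨c, hc⟩ := hC.unit_simple.exists_smul (dimension 𝕜 (grading 1))
  have hsum : ∑ i, dimL (D.S i) ≫ dimR (D.S i) = c • 𝟙 (𝟙_ C) := by
    rw [← hc, dimension, finsum_eq_sum_of_fintype]
    rfl
  have hc0 : c ≠ 0 := by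
    rintro rfl
    exact hdim (by rw [hc, zero_smul])
  refine isSplitSemisimple_of_regular (fun A => ?_) fun f => ?_
  · have := hss.finite_hom A.pt A.pt
    exact RelCenter.finite_hom A A
  · exact RelCenter.isVonNeumannRegular D hd hC.unit_simple.id_ne_zero hsum hc0 f
      (hss.isVonNeumannRegular f.f)

theorem exists_simple_center [IsAlgClosed 𝕜] (hC : IsGFusion 𝕜 grading)
    (hdim : dimension 𝕜 (grading 1) ≠ 0) (α : G) :
    ∃ A, centerGrading grading α A ∧ IsSimpleObj 𝕜 A := by
  have : Fintype (simpleClasses 𝕜 (grading 1)) := (hC.finite_simple 1).fintype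
  let D := hC.splitSemisimple.simpleSystem grading 1
  obtain ⟨i, d, hd, hd0⟩ := exists_dimL_ne_zero hC.unit_simple hdim
  obtain ⟨X, hX, hXs⟩ := hC.exists_simple α
  obtain ⟨F, hF, ⟨s⟩⟩ := D.exists_splitting hX
  have hind : centerGrading grading α (D.induced s) := hF
  exact (hC.isSplitSemisimple_center hdim).exists_simple_mem hind
    (RelCenter.id_induced_ne_zero D s (i := i) hd hd0 hXs.id_ne_zero)

theorem finite_simple_center [IsAlgClosed 𝕜] (hC : IsGFusion 𝕜 grading)
    (hdim : dimension 𝕜 (grading 1) ≠ 0) (α : G) :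
    (simpleClasses 𝕜 (centerGrading grading α)).Finite := by
  have : Fintype (simpleClasses 𝕜 (grading 1)) := (hC.finite_simple 1).fintype
  have : Finite (simpleClasses 𝕜 (grading α)) := hC.finite_simple α
  let D := hC.splitSemisimple.simpleSystem grading 1
  obtain ⟨i, d, hd, hd0⟩ := exists_dimL_ne_zero hC.unit_simple hdim
  choose F _ s using fun c : simpleClasses 𝕜 (grading α) => D.exists_splitting (simpleRep_mem c)
  refine (hC.isSplitSemisimple_center hdim).finite_simpleClasses
    (fun c => D.induced (s c).some) fun A hA hAs => ?_
  obtain ⟨c, f, hf⟩ := hC.splitSemisimple.exists_hom_simpleRep_ne_zero (X := A.pt) hA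
    fun h => hAs.id_ne_zero (RelCenter.hom_ext h)
  exact ⟨c, _, RelCenter.toInduced_ne_zero D (s c).some (i := i) hd hd0 hf⟩

end IsGFusion
end Fusion

end TV

end

theorem lemma4p3 {𝕜 : Type w} [Field 𝕜] [IsAlgClosed 𝕜] {G : Type w'} [Group G]
    {C : Type u} [Category.{v} C] [MonoidalCategory C] [Preadditive C] [MonoidalPreadditive C]
    [Linear 𝕜 C] [MonoidalLinear 𝕜 C] [TV.PivotalCategory C]
    (grading : G → ObjectProperty C) [TV.IsPivotalGraded grading]
    (hC : TV.IsGFusion 𝕜 grading) (hdim : TV.dimension 𝕜 (grading 1) ≠ 0) :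
    TV.IsGFusion 𝕜 (TV.centerGrading grading) ∧
      ((∀ (α β : G) (X : C), grading α X → grading β X → α = β) →
        ∀ (α β : G) (A : TV.GCenter grading),
          TV.centerGrading grading α A → TV.centerGrading grading β A → α = β) :=
  ⟨{ unit_simple := TV.RelCenter.isSimpleObj_unit hC.unit_simple
     splitSemisimple := hC.isSplitSemisimple_center hdim
     exists_simple := hC.exists_simple_center hdim
     finite_simple := hC.finite_simple_center hdim },
    fun h α β A hA hB => h α β A.pt hA hB⟩
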